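/- Let $H$ be a complex Hilbert space with an orthonormal basis $(e_i)_{i\ge1}$. The weakly monotone Fock space over $H$ is the closed subspace of the full Fock space $\bigoplus_{k\ge0}H^{\otimes k}$ spanned by the vacuum vector $\Omega=1\oplus0\oplus\cdots$ and all the simple tensors $e_{i_k}\otimes\cdots\otimes e_{i_1}$ with $k\ge1$ and $i_k\ge\cdots\ge i_1$. On it let $A_i$ be the bounded operator with $A_i\Omega=0$ and $A_i(e_{i_k}\otimes e_{i_{k-1}}\otimes\cdots\otimes e_{i_1})=\delta_{i,i_k}\,e_{i_{k-1}}\otimes\cdots\otimes e_{i_1}$ (which is $\delta_{i,i_1}\Omega$ if $k=1$), and let $A_i^\dagger$ be its adjoint, so that $A_i^\dagger\Omega=e_i$, and $A_i^\dagger(e_{i_k}\otimes\cdots\otimes e_{i_1})$ is $e_i\otimes e_{i_k}\otimes\cdots\otimes e_{i_1}$ if $i\ge i_k$ and $0$ otherwise. Put $G_i=A_i+A_i^\dagger$ and $A_i^0=A_i^\dagger A_i$. The vacuum law of a bounded selfadjoint operator $T$ on this space is the unique Borel probability measure on $\mathbb R$ with all moments finite whose $n$-th moment is $\langle T^n\Omega,\Omega\rangle$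 for every $n\ge0$. The free Meixner law with parameters $(a,b,c,\alpha)$, where $b\ge0$ and $c>0$, is the unique probability measure on $\mathbb R$ with all moments finite for which the polynomials $P_0=c$, $P_1(x)=x-\alpha$, $P_{n+1}(x)=(x-a)P_n(x)-bP_{n-1}(x)$ $(n\ge1)$ are pairwise orthogonal. **Theorem.** For every $\lambda>0$, the vacuum law of $$\frac{G_1+\cdots+G_m+\lambda\sqrt m\,(A_1^0+\cdots+A_m^0)}{\sqrt m}$$ converges weakly, as $m\to\infty$, to the free Meixner law $\nu_\lambda$ with parameters $(\lambda,\tfrac12,2,0)$. Moreover $$\nu_\lambda=\frac{\lambda}{\sqrt{\lambda^2+2}}\,\delta_{\lambda-\sqrt{\lambda^2+2}}+\nu_\lambda^{\mathrm{a.c.}},$$ where the absolutely continuous part $\nu_\lambda^{\mathrm{a.c.}}$ has the density $$\frac{\sqrt{2-(x-\lambda)^2}}{\pi\,(\lambda^2+2-(x-\lambda)^2)}\,\chi_{(\lambda-\sqrt2,\lambda+\sqrt2)}(x)$$ with respect to Lebesgue measure. -/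

import Mathlib

open MeasureTheory Filter Topology
open scoped TensorProduct InnerProductSpace ENNReal

noncomputable section

namespace WMFock

universe u

/-! ### The full Fock space of a Hilbert space -/

/-- Bundled complex inner product spaces, used to define tensor powers by recursion. -/
structure PreHilbert : Type (u + 1) where
  carrier : Type u
  [group : NormedAddCommGroup carrier]
  [inner : InnerProductSpace ℂ carrier]

attribute [instance] PreHilbert.group PreHilbert.inner

section

variable (H : Type u) [NormedAddCommGroup H] [InnerProductSpace ℂ H]

/-- The algebraic tensor powers of `H` with their inner products. The zeroth power is the scalar
field, written as a one-dimensional Euclidean space so that it lives in the universe of `H`. -/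
def algPower : ℕ → PreHilbert.{u}
  | 0 => ⟨EuclideanSpace ℂ PUnit.{u + 1}⟩
  | n + 1 => ⟨H ⊗[ℂ] (algPower n).carrier⟩

/-- The Hilbert space tensor power. -/
abbrev tensorPower (n : ℕ) : Type u := UniformSpace.Completion (algPower H n).carrier

/-- The full Fock space: the Hilbert space direct sum of all the tensor powers of `H`. -/
abbrev FullFock : Type u := lp (fun n : ℕ => tensorPower H n) 2

variable {H}

/-- The simple tensor of a list of vectors; the empty list gives the scalar `1`. -/
def simpleTensor : (v : List H) → (algPower H v.length).carrier
  | [] => EuclideanSpace.single PUnit.unit (1 : ℂ)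
  | h :: v => (h ⊗ₜ[ℂ] simpleTensor v : H ⊗[ℂ] (algPower H v.length).carrier)

/-- A simple tensor as a vector of the full Fock space; the empty list gives `1 ⊕ 0 ⊕ ⋯`. -/
def fockTensor (v : List H) : FullFock H :=
  lp.single 2 v.length (simpleTensor v : tensorPower H v.length)

lemma single_cast {i j : ℕ} (h : j = i) (x : (algPower H j).carrier) :
    (lp.single (E := fun n : ℕ => tensorPower H n) 2 j (x : tensorPower H j)) i
      = ((h ▸ x : (algPower H i).carrier) : tensorPower H i) := by
  subst h
  simp

lemma cast_tmul {i j : ℕ} (h : j + 1 = i + 1) (h' : j = i) (a : H)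
    (x : (algPower H j).carrier) :
    (h ▸ (show (algPower H (j + 1)).carrier from a ⊗ₜ[ℂ] x) : (algPower H (i + 1)).carrier)
      = (a ⊗ₜ[ℂ] (h' ▸ x : (algPower H i).carrier) : H ⊗[ℂ] (algPower H i).carrier) := by
  subst h'
  rfl

lemma inner_simpleTensor {ι : Type*} [DecidableEq ι] {e : ι → H} (he : Orthonormal ℂ e)
    (v w : List ι) (h : (w.map e).length = (v.map e).length) :
    inner ℂ (simpleTensor (v.map e)) (h ▸ simpleTensor (w.map e)) = if v = w then 1 else 0 := by
  induction v generalizing w with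
  | nil =>
    cases w with
    | nil =>
      change inner ℂ (EuclideanSpace.single PUnit.unit (1 : ℂ))
        (EuclideanSpace.single PUnit.unit (1 : ℂ)) = _
      simp
    | cons b w => simp at h
  | cons a v ih =>
    cases w with
    | nil => simp at h
    | cons b w =>
      have h' : (w.map e).length = (v.map e).length := by simpa using h
      have key := cast_tmul (H := H) (i := (v.map e).length) (j := (w.map e).length)
        (by simpa using h) h' (e b) (simpleTensor (w.map e))
      change inner ℂ (e a ⊗ₜ[ℂ] simpleTensor (v.map e) :
        H ⊗[ℂ] (algPower H (v.map e).length).carrier) _ = _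
      refine (congrArg (fun z => inner ℂ (e a ⊗ₜ[ℂ] simpleTensor (v.map e) :
        H ⊗[ℂ] (algPower H (v.map e).length).carrier) z) key).trans ?_
      rw [TensorProduct.inner_tmul, ih w h', orthonormal_iff_ite.mp he a b]
      by_cases h1 : a = b <;> by_cases h2 : v = w <;> simp [h1, h2]

lemma inner_fockTensor {ι : Type*} [DecidableEq ι] {e : ι → H} (he : Orthonormal ℂ e)
    (v w : List ι) :
    inner ℂ (fockTensor (v.map e)) (fockTensor (w.map e)) = if v = w then (1 : ℂ) else 0 := by
  unfold fockTensor
  rw [lp.inner_single_left]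
  by_cases h : (w.map e).length = (v.map e).length
  · rw [single_cast h, UniformSpace.Completion.inner_coe, inner_simpleTensor he]
  · have hne : v ≠ w := by rintro rfl; exact h rfl
    rw [lp.single_apply_ne _ _ _ (fun hh => h hh.symm)]
    simp [hne]

end

/-! ### The weakly monotone Fock space -/

/-- The words `i_k, …, i_1` with `i_k ≥ ⋯ ≥ i_1`, `k ≥ 0`. -/
abbrev Word : Type := {w : List ℕ // w.Pairwise (· ≥ ·)}

variable {H : Type u} [NormedAddCommGroup H] [InnerProductSpace ℂ H]

/-- The weakly monotone Fock space: the closed span of the simple tensors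
`e_{i_k} ⊗ ⋯ ⊗ e_{i_1}` with `i_k ≥ ⋯ ≥ i_1`, the vacuum (`k = 0`) included. The basis vectors are
numbered from `0` instead of from `1`. -/
def wmSubspace (e : HilbertBasis ℕ ℂ H) : Submodule ℂ (FullFock H) :=
  (Submodule.span ℂ (Set.range fun w : Word => fockTensor (w.1.map e))).topologicalClosure

abbrev Space (e : HilbertBasis ℕ ℂ H) : Type u := wmSubspace e

instance (e : HilbertBasis ℕ ℂ H) : CompleteSpace (Space e) :=
  (Submodule.isClosed_topologicalClosure _).completeSpace_coe

/-- The generator `e_{i_k} ⊗ ⋯ ⊗ e_{i_1}`. -/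
def gen (e : HilbertBasis ℕ ℂ H) (w : Word) : Space e :=
  ⟨fockTensor (w.1.map e), Submodule.le_topologicalClosure _ (Submodule.subset_span ⟨w, rfl⟩)⟩

/-- The vacuum vector. -/
def vacuum (e : HilbertBasis ℕ ℂ H) : Space e := gen e ⟨[], List.Pairwise.nil⟩

lemma orthonormal_gen (e : HilbertBasis ℕ ℂ H) : Orthonormal ℂ (gen e) := by
  classical
  rw [orthonormal_iff_ite]
  intro v w
  change inner ℂ (fockTensor (v.1.map e)) (fockTensor (w.1.map e)) = _
  rw [inner_fockTensor e.orthonormal]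
  simp [Subtype.ext_iff]

lemma dense_gen (e : HilbertBasis ℕ ℂ H) :
    ⊤ ≤ (Submodule.span ℂ (Set.range (gen e))).topologicalClosure := by
  rintro ⟨x, hx⟩ -
  change _ ∈ closure _
  rw [closure_subtype]
  refine closure_mono ?_ hx
  intro y hy
  have hmap : (Submodule.span ℂ (Set.range (gen e))).map (wmSubspace e).subtype
      = Submodule.span ℂ (Set.range fun w : Word => fockTensor (w.1.map e)) := by
    rw [Submodule.map_span, ← Set.range_comp]
    rfl
  have hy' : y ∈ (Submodule.span ℂ (Set.range (gen e))).map (wmSubspace e).subtype := by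
    rw [hmap]; exact hy
  obtain ⟨z, hz, rfl⟩ := hy'
  exact ⟨z, hz, rfl⟩

/-- The generators form a Hilbert basis of the weakly monotone Fock space. -/
def basis (e : HilbertBasis ℕ ℂ H) : HilbertBasis Word ℂ (Space e) :=
  HilbertBasis.mk (orthonormal_gen e) (dense_gen e)

lemma basis_apply (e : HilbertBasis ℕ ℂ H) (w : Word) : basis e w = gen e w := by
  simp [basis]

/-! ### Annihilation, creation and preservation operators -/

/-- The coordinates of `A_i f`: the coefficient of `A_i f` at `w` is that of `f` at `i w` if `i w`
is a weakly monotone word, and is `0` otherwise. -/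
def annihilFun (i : ℕ) (f : Word → ℂ) (w : Word) : ℂ :=
  if h : (i :: w.1).Pairwise (· ≥ ·) then f ⟨i :: w.1, h⟩ else 0

lemma sum_annihilFun_le (i : ℕ) (f : lp (fun _ : Word => ℂ) 2) (s : Finset Word) :
    ∑ w ∈ s, ‖annihilFun i f w‖ ^ (2 : ℝ≥0∞).toReal ≤ ‖f‖ ^ (2 : ℝ≥0∞).toReal := by
  classical
  let t : Finset Word := s.filter fun w => (i :: w.1).Pairwise (· ≥ ·)
  let g : Word → Word := fun w =>
    if h : (i :: w.1).Pairwise (· ≥ ·) then ⟨i :: w.1, h⟩ else w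
  have h1 : ∑ w ∈ s, ‖annihilFun i f w‖ ^ (2 : ℝ≥0∞).toReal
      = ∑ w ∈ t, ‖f (g w)‖ ^ (2 : ℝ≥0∞).toReal := by
    rw [Finset.sum_filter]
    refine Finset.sum_congr rfl fun w _ => ?_
    by_cases h : (i :: w.1).Pairwise (· ≥ ·)
    · simp only [annihilFun, g, dif_pos h, if_pos h]
    · simp only [annihilFun, dif_neg h, if_neg h]
      simp
  have hinj : Set.InjOn g t := by
    intro v hv w hw hvw
    have hv' := (Finset.mem_filter.mp hv).2
    have hw' := (Finset.mem_filter.mp hw).2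
    simp only [g, dif_pos hv', dif_pos hw', Subtype.mk.injEq, List.cons.injEq, true_and] at hvw
    exact Subtype.ext hvw
  have h2 : ∑ w ∈ t, ‖f (g w)‖ ^ (2 : ℝ≥0∞).toReal
      = ∑ w ∈ t.image g, ‖f w‖ ^ (2 : ℝ≥0∞).toReal :=
    (Finset.sum_image (f := fun w => ‖f w‖ ^ (2 : ℝ≥0∞).toReal) hinj).symm
  rw [h1, h2]
  exact lp.sum_rpow_le_norm_rpow (by simp) f _

lemma annihilFun_memℓp (i : ℕ) (f : lp (fun _ : Word => ℂ) 2) :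
    Memℓp (E := fun _ : Word => ℂ) (annihilFun i f) 2 :=
  memℓp_gen' (sum_annihilFun_le i f)

/-- The annihilation operator in coordinates. -/
def annihilCoord (i : ℕ) :
    lp (fun _ : Word => ℂ) 2 →L[ℂ] lp (fun _ : Word => ℂ) 2 :=
  LinearMap.mkContinuous
    { toFun := fun f => ⟨annihilFun i f, annihilFun_memℓp i f⟩
      map_add' := by
        intro f g
        ext w
        change annihilFun i (f + g) w = annihilFun i f w + annihilFun i g w
        by_cases h : (i :: w.1).Pairwise (· ≥ ·) <;> simp [annihilFun, h]
      map_smul' := by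
        intro c f
        ext w
        by_cases h : (i :: w.1).Pairwise (· ≥ ·) <;> simp [annihilFun, h] }
    1
    (by
      intro f
      rw [one_mul]
      exact lp.norm_le_of_forall_sum_le (by simp) (norm_nonneg f) (sum_annihilFun_le i f))

/-- The annihilation operator `A_i`. -/
def annihil (e : HilbertBasis ℕ ℂ H) (i : ℕ) : Space e →L[ℂ] Space e :=
  ((basis e).repr.symm.toContinuousLinearEquiv.toContinuousLinearMap.comp (annihilCoord i)).comp
    (basis e).repr.toContinuousLinearEquiv.toContinuousLinearMap

/-- The creation operator `A_i†`, the adjoint of `A_i`. -/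
def creat (e : HilbertBasis ℕ ℂ H) (i : ℕ) : Space e →L[ℂ] Space e :=
  ContinuousLinearMap.adjoint (annihil e i)

lemma repr_annihil (e : HilbertBasis ℕ ℂ H) (i : ℕ) (x : Space e) (w : Word) :
    (basis e).repr (annihil e i x) w = annihilFun i ((basis e).repr x) w := by
  simp [annihil, annihilCoord]

lemma annihil_vacuum (e : HilbertBasis ℕ ℂ H) (i : ℕ) : annihil e i (vacuum e) = 0 := by
  classical
  apply (basis e).repr.injective
  ext w
  rw [repr_annihil, vacuum, ← basis_apply, HilbertBasis.repr_self, map_zero]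
  by_cases h : (i :: w.1).Pairwise (· ≥ ·)
  · simp [annihilFun, h, lp.single_apply]
  · simp [annihilFun, h]

/-- `A_i (e_{i_k} ⊗ e_{i_{k-1}} ⊗ ⋯) = δ_{i, i_k} e_{i_{k-1}} ⊗ ⋯`. -/
lemma annihil_cons (e : HilbertBasis ℕ ℂ H) (i j : ℕ) (w : List ℕ)
    (hw : (j :: w).Pairwise (· ≥ ·)) :
    annihil e i (gen e ⟨j :: w, hw⟩) = if i = j then gen e ⟨w, hw.of_cons⟩ else 0 := by
  classical
  apply (basis e).repr.injective
  ext v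
  rw [repr_annihil, ← basis_apply, HilbertBasis.repr_self]
  by_cases hij : i = j
  · subst hij
    rw [if_pos rfl, ← basis_apply, HilbertBasis.repr_self]
    by_cases hv : v.1 = w
    · have hv' : v = ⟨w, hw.of_cons⟩ := Subtype.ext hv
      subst hv'
      simp [annihilFun, hw]
    · have hv' : v ≠ ⟨w, hw.of_cons⟩ := fun h => hv (congrArg Subtype.val h)
      by_cases h : (i :: v.1).Pairwise (· ≥ ·)
      · simp [annihilFun, h, lp.single_apply, hv, hv']
      · simp [annihilFun, h, lp.single_apply, hv']
  · rw [if_neg hij, map_zero]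
    by_cases h : (i :: v.1).Pairwise (· ≥ ·)
    · simp [annihilFun, h, lp.single_apply, hij]
    · simp [annihilFun, h]

/-- `A_i† Ω = e_i` and `A_i† (e_{i_k} ⊗ ⋯) = α_{i, i_k} e_i ⊗ e_{i_k} ⊗ ⋯`, where `α_{i, j} = 1` if
`i ≥ j` and `α_{i, j} = 0` otherwise. -/
lemma creat_gen (e : HilbertBasis ℕ ℂ H) (i : ℕ) (w : Word) :
    creat e i (gen e w)
      = if h : (i :: w.1).Pairwise (· ≥ ·) then gen e ⟨i :: w.1, h⟩ else 0 := by
  classical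
  have hon := orthonormal_iff_ite.mp (orthonormal_gen e)
  apply (basis e).repr.injective
  ext v
  rw [HilbertBasis.repr_apply_apply, HilbertBasis.repr_apply_apply, creat,
    ContinuousLinearMap.adjoint_inner_right, basis_apply]
  obtain ⟨v, hv⟩ := v
  cases v with
  | nil =>
    have h0 : annihil e i (gen e ⟨[], hv⟩) = 0 := annihil_vacuum e i
    rw [h0, inner_zero_left]
    by_cases h : (i :: w.1).Pairwise (· ≥ ·)
    · rw [dif_pos h, hon]
      simp
    · rw [dif_neg h, inner_zero_right]
  | cons j v =>
    rw [annihil_cons]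
    by_cases hij : i = j
    · subst hij
      rw [if_pos rfl, hon]
      by_cases h : (i :: w.1).Pairwise (· ≥ ·)
      · rw [dif_pos h, hon]
        simp [Subtype.ext_iff]
      · rw [dif_neg h, inner_zero_right, if_neg]
        rintro rfl
        exact h hv
    · rw [if_neg hij, inner_zero_left]
      by_cases h : (i :: w.1).Pairwise (· ≥ ·)
      · rw [dif_pos h, hon, if_neg]
        intro hh
        simp only [Subtype.mk.injEq, List.cons.injEq] at hh
        exact hij hh.1.symm
      · rw [dif_neg h, inner_zero_right]

/-- The preservation operator `A_i⁰ = A_i† A_i`. -/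
def preserv (e : HilbertBasis ℕ ℂ H) (i : ℕ) : Space e →L[ℂ] Space e :=
  creat e i * annihil e i

/-- `G_i = A_i + A_i†`. -/
def gauss (e : HilbertBasis ℕ ℂ H) (i : ℕ) : Space e →L[ℂ] Space e :=
  annihil e i + creat e i

/-- `(G_1 + ⋯ + G_m + l √m (A_1⁰ + ⋯ + A_m⁰)) / √m`. -/
def normalizedSum (e : HilbertBasis ℕ ℂ H) (l : ℝ) (m : ℕ) : Space e →L[ℂ] Space e :=
  (((Real.sqrt m)⁻¹ : ℝ) : ℂ) •
    (∑ i ∈ Finset.range m, gauss e i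
      + ((l * Real.sqrt m : ℝ) : ℂ) • ∑ i ∈ Finset.range m, preserv e i)

/-- `ρ` is the vacuum law of `T`: a probability measure whose `n`-th moment exists and is
`⟨Tⁿ Ω, Ω⟩`, for every `n`. -/
def IsVacuumLaw (e : HilbertBasis ℕ ℂ H) (T : Space e →L[ℂ] Space e) (ρ : Measure ℝ) : Prop :=
  IsProbabilityMeasure ρ ∧ ∀ n : ℕ, Integrable (fun x : ℝ => x ^ n) ρ ∧
    ((∫ x, x ^ n ∂ρ : ℝ) : ℂ) = inner ℂ (vacuum e) ((T ^ n) (vacuum e))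

/-! ### Free Meixner laws -/

/-- The polynomials `P_0 = c`, `P_1 = x - α`, `P_{n+1} = (x - a) P_n - b P_{n-1}`. -/
def meixnerPoly (a b c α : ℝ) : ℕ → Polynomial ℝ
  | 0 => Polynomial.C c
  | 1 => Polynomial.X - Polynomial.C α
  | n + 2 => (Polynomial.X - Polynomial.C a) * meixnerPoly a b c α (n + 1)
      - Polynomial.C b * meixnerPoly a b c α n

/-- `ρ` is the free Meixner law with parameters `(a, b, c, α)`: a probability measure with finite
moments that orthogonalizes the polynomials above. The third condition is a case of the fourth if
`c ≠ 0`; it keeps the constants in the orthogonal system if `c = 0`. -/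
def IsFreeMeixnerLaw (a b c α : ℝ) (ρ : Measure ℝ) : Prop :=
  IsProbabilityMeasure ρ ∧ (∀ n : ℕ, Integrable (fun x : ℝ => x ^ n) ρ) ∧
    (∀ n : ℕ, 1 ≤ n → ∫ x, (meixnerPoly a b c α n).eval x ∂ρ = 0) ∧
    ∀ m n : ℕ, m ≠ n →
      ∫ x, (meixnerPoly a b c α m).eval x * (meixnerPoly a b c α n).eval x ∂ρ = 0

end WMFock

end

/-!
The moments of a bounded selfadjoint operator at the vacuum are those of its spectral measure, and
geometrically bounded moments determine a measure on the line. Weak convergence of laws carried by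
one compact interval is convergence of moments, and this follows from the convergence of the moment
generating functions `F(t) = ∑ mₙ tⁿ = ⟨Ω, (1 - t T)⁻¹ Ω⟩` at small `t > 0`.

*The normalized sums.* On words with letters below `m` the preservation part is `l` times the
projection onto the complement of the vacuum. The words that can be put on top of a letter `i`
depend only on the number `m - i` of letters `≥ i`, so the coordinates of the resolvent at the
vacuum factor letter by letter (`resolventCoord`, `resolventCoord_eq`). The factors are reciprocals
of denominators with `d₀ = 1 - l t` and `d_{j+1} = d_j - (t² / m) / d_{j+1}`. This is the implicit
Euler scheme with step `1 / m` for `d' = - t² / d`, whose solution satisfies `d(1)² = d₀² - 2 t²`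
(`abs_denom_sq_sub_le`). Hence `F(t) → 1 / (l t + √((1 - l t)² - 2 t²))`
(`tendsto_tsum_walkMoment`).

*The limit law.* Put `x = l + √2 cos θ`. Up to powers of `√2`, the Meixner polynomials satisfy the
Chebyshev recurrence in `cos θ`, and their integrals against the absolutely continuous part become
contour integrals over the unit circle with one simple pole inside it, apart from a pole at the
origin for the constant polynomial (`integral_angle`). The residue cancels against the atom
(`integral_meixnerPoly_meixnerMeasure`). By the three-term recurrence the vanishing of these
integrals gives the full orthogonality (`functional_meixnerPoly_mul`) and determines all moments
(`moments_eq_of_isFreeMeixnerLaw`). Summing the polynomials to a generating function in `s`, where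
`t = s / (1 + l s + s² / 2)`, gives `F(t) = (1 + l s + s² / 2) / (1 + l s - s² / 2)`
(`tsum_moments_of_isFreeMeixnerLaw`), which is the limit found above (`tendsto_walkMoment`).
-/

noncomputable section

namespace WMFock

/-! ### Moments and weak convergence -/

lemma integrable_of_ae_abs_le {ρ : Measure ℝ} [IsFiniteMeasure ρ] {C : ℝ}
    (hρ : ∀ᵐ x ∂ρ, |x| ≤ C) {f : ℝ → ℝ} (hf : Continuous f) : Integrable f ρ := by
  obtain ⟨B, hB⟩ := (isCompact_Icc (a := -C) (b := C)).exists_bound_of_continuousOn hf.continuousOn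
  refine Integrable.of_bound hf.aestronglyMeasurable B ?_
  filter_upwards [hρ] with x hx
  exact hB x (abs_le.mp hx)

/-- A probability measure whose even moments grow at most like `C ^ (2 n)` is carried by
`[-C, C]`: by Markov's inequality, `ρ {C' < |x|} ≤ (C / C') ^ (2 n)` for every `n`. -/
lemma ae_abs_le_of_moments {ρ : Measure ℝ} [IsProbabilityMeasure ρ] {C : ℝ} (hC : 0 < C)
    (hi : ∀ n : ℕ, Integrable (fun x : ℝ => x ^ n) ρ)
    (hb : ∀ n : ℕ, |∫ x, x ^ n ∂ρ| ≤ C ^ n) : ∀ᵐ x ∂ρ, |x| ≤ C := by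
  have key : ∀ D : ℝ, C < D → ρ.real {x | D ≤ |x|} = 0 := by
    intro D hD
    have hD0 : 0 < D := hC.trans hD
    have hle : ∀ n : ℕ, ρ.real {x | D ≤ |x|} ≤ ((C / D) ^ 2) ^ n := by
      intro n
      have h1 := mul_meas_ge_le_integral_of_nonneg (μ := ρ) (f := fun x : ℝ => x ^ (2 * n))
        (ae_of_all _ fun x => (even_two_mul n).pow_nonneg x) (hi _) (D ^ (2 * n))
      have hset : {x : ℝ | D ≤ |x|} ⊆ {x | D ^ (2 * n) ≤ x ^ (2 * n)} := by
        intro x hx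
        change D ^ (2 * n) ≤ x ^ (2 * n)
        rw [← (even_two_mul n).pow_abs x]
        exact pow_le_pow_left₀ hD0.le hx _
      have h2 : D ^ (2 * n) * ρ.real {x | D ≤ |x|} ≤ C ^ (2 * n) :=
        (mul_le_mul_of_nonneg_left (measureReal_mono hset) (by positivity)).trans
          (h1.trans ((le_abs_self _).trans (hb _)))
      rw [← pow_mul, div_pow, le_div_iff₀ (by positivity), mul_comm]
      exact h2
    have hlim : Tendsto (fun n : ℕ => ((C / D) ^ 2) ^ n) atTop (𝓝 0) := by
      refine tendsto_pow_atTop_nhds_zero_of_lt_one (by positivity) ?_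
      have : C / D < 1 := (div_lt_one hD0).2 hD
      exact pow_lt_one₀ (by positivity) this two_ne_zero
    exact le_antisymm (ge_of_tendsto' hlim hle) measureReal_nonneg
  have hall : ∀ᵐ x ∂ρ, ∀ k : ℕ, ¬ (C + 1 / ((k : ℝ) + 1) ≤ |x|) := by
    rw [ae_all_iff]
    intro k
    have h0 := key (C + 1 / ((k : ℝ) + 1)) (lt_add_of_pos_right _ (by positivity))
    rw [measureReal_eq_zero_iff] at h0
    rw [ae_iff]
    simpa using h0
  filter_upwards [hall] with x hx
  by_contra! h
  obtain ⟨k, hk⟩ := exists_nat_one_div_lt (sub_pos.2 h)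
  exact hx k (by linarith)

/-- For probability measures carried by one fixed compact interval, convergence of all moments
implies weak convergence, by Weierstrass' approximation theorem. -/
lemma tendsto_of_moments {ι : Type*} {F : Filter ι} {μ : ι → ProbabilityMeasure ℝ}
    {ν : ProbabilityMeasure ℝ} {C : ℝ} (hμ : ∀ᶠ i in F, ∀ᵐ x ∂(μ i : Measure ℝ), |x| ≤ C)
    (hν : ∀ᵐ x ∂(ν : Measure ℝ), |x| ≤ C)
    (h : ∀ n : ℕ, Tendsto (fun i => ∫ x, x ^ n ∂(μ i : Measure ℝ)) F
      (𝓝 (∫ x, x ^ n ∂(ν : Measure ℝ)))) : Tendsto μ F (𝓝 ν) := by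
  have eval_int : ∀ (ρ : ProbabilityMeasure ℝ), (∀ᵐ x ∂(ρ : Measure ℝ), |x| ≤ C) →
      ∀ p : Polynomial ℝ, ∫ x, p.eval x ∂(ρ : Measure ℝ)
        = ∑ k ∈ Finset.range (p.natDegree + 1), p.coeff k * ∫ x, x ^ k ∂(ρ : Measure ℝ) := by
    intro ρ hρ p
    simp_rw [Polynomial.eval_eq_sum_range]
    rw [integral_finsetSum]
    · simp_rw [integral_const_mul]
    · exact fun k _ => integrable_of_ae_abs_le hρ (by fun_prop)
  have hpoly : ∀ p : Polynomial ℝ, Tendsto (fun i => ∫ x, p.eval x ∂(μ i : Measure ℝ)) F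
      (𝓝 (∫ x, p.eval x ∂(ν : Measure ℝ))) := by
    intro p
    rw [eval_int ν hν p]
    refine Tendsto.congr' ?_ (tendsto_finsetSum _ fun k _ => (h k).const_mul (p.coeff k))
    filter_upwards [hμ] with i hi
    rw [eval_int _ hi p]
  have close : ∀ (ρ : ProbabilityMeasure ℝ), (∀ᵐ x ∂(ρ : Measure ℝ), |x| ≤ C) →
      ∀ (f g : ℝ → ℝ) (ε : ℝ), Continuous f → Continuous g →
        (∀ x ∈ Set.Icc (-C) C, |g x - f x| < ε) →
        |∫ x, g x ∂(ρ : Measure ℝ) - ∫ x, f x ∂(ρ : Measure ℝ)| ≤ ε := by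
    intro ρ hρ f g ε hf hg hfg
    rw [← integral_sub (integrable_of_ae_abs_le hρ hg) (integrable_of_ae_abs_le hρ hf)]
    have := norm_integral_le_of_norm_le_const (μ := (ρ : Measure ℝ)) (C := ε)
      (f := fun x => g x - f x)
      (by filter_upwards [hρ] with x hx using (hfg x (abs_le.mp hx)).le)
    simpa using this
  rw [ProbabilityMeasure.tendsto_iff_forall_integral_tendsto]
  intro f
  rw [Metric.tendsto_nhds]
  intro ε hε
  obtain ⟨p, hp⟩ := exists_polynomial_near_of_continuousOn (-C) C f f.continuous.continuousOn
    (ε / 3) (by positivity)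
  filter_upwards [hμ, (Metric.tendsto_nhds.1 (hpoly p)) (ε / 3) (by positivity)] with i hi hpi
  have h1 := close (μ i) hi f (fun x => p.eval x) _ f.continuous p.continuous hp
  have h2 := close ν hν f (fun x => p.eval x) _ f.continuous p.continuous hp
  rw [Real.dist_eq] at hpi ⊢
  rw [abs_lt] at hpi ⊢
  rw [abs_le] at h1 h2
  constructor <;> linarith [hpi.1, hpi.2, h1.1, h1.2, h2.1, h2.2]

/-- The moment problem with geometrically bounded moments is determinate. -/
lemma eq_of_moments {ρ σ : Measure ℝ} [IsProbabilityMeasure ρ] [IsProbabilityMeasure σ] {C : ℝ}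
    (hC : 0 < C) (hρ : ∀ n : ℕ, Integrable (fun x : ℝ => x ^ n) ρ)
    (hσ : ∀ n : ℕ, Integrable (fun x : ℝ => x ^ n) σ)
    (hb : ∀ n : ℕ, |∫ x, x ^ n ∂ρ| ≤ C ^ n)
    (h : ∀ n : ℕ, ∫ x, x ^ n ∂ρ = ∫ x, x ^ n ∂σ) : ρ = σ := by
  have h1 := ae_abs_le_of_moments hC hρ hb
  have h2 := ae_abs_le_of_moments hC hσ (fun n => h n ▸ hb n)
  let ρ' : ProbabilityMeasure ℝ := ⟨ρ, inferInstance⟩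
  let σ' : ProbabilityMeasure ℝ := ⟨σ, inferInstance⟩
  have ht : Tendsto (fun _ : ℕ => ρ') atTop (𝓝 σ') :=
    tendsto_of_moments (C := C) (Eventually.of_forall fun _ => h1) h2 fun n => by
      change Tendsto (fun _ : ℕ => ∫ x, x ^ n ∂ρ) atTop (𝓝 (∫ x, x ^ n ∂σ))
      rw [h n]
      exact tendsto_const_nhds
  exact congrArg Subtype.val (tendsto_nhds_unique tendsto_const_nhds ht : ρ' = σ')

/-- Power series with a common geometric bound on their coefficients that converge pointwise at
arbitrarily small positive arguments converge coefficientwise. -/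
lemma tendsto_coeff_of_tendsto_sum {a : ℕ → ℕ → ℝ} {b : ℕ → ℝ} {C : ℝ} (hC : 0 < C)
    (ha : ∀ᶠ m in atTop, ∀ n, |a m n| ≤ C ^ n) (hb : ∀ n, |b n| ≤ C ^ n)
    (h : ∃ᶠ t : ℝ in 𝓝[>] 0,
      Tendsto (fun m => ∑' n, a m n * t ^ n) atTop (𝓝 (∑' n, b n * t ^ n))) (n : ℕ) :
    Tendsto (fun m => a m n) atTop (𝓝 (b n)) := by
  have hsum : ∀ t : ℝ, 0 < t → C * t ≤ 1 / 2 → ∀ c : ℕ → ℝ, (∀ k, |c k| ≤ C ^ k) →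
      Summable (fun k => c k * t ^ k) ∧ ∀ n,
        |∑' k, c (k + n) * t ^ (k + n) - c n * t ^ n| ≤ 2 * (C * t) ^ (n + 1) := by
    intro t ht hCt c hc
    have hbd : ∀ k, ‖c k * t ^ k‖ ≤ (C * t) ^ k := fun k => by
      rw [Real.norm_eq_abs, abs_mul, abs_of_nonneg (pow_nonneg ht.le k), mul_pow]
      exact mul_le_mul_of_nonneg_right (hc k) (by positivity)
    have hCt0 : 0 ≤ C * t := by positivity
    have hg := summable_geometric_of_lt_one hCt0 (by linarith)
    have hs : Summable (fun k => c k * t ^ k) := Summable.of_norm_bounded hg hbd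
    refine ⟨hs, fun n => ?_⟩
    have hs' := (summable_nat_add_iff n).2 hs
    rw [hs'.tsum_eq_zero_add]
    have h1 : HasSum (fun k : ℕ => (C * t) ^ (n + 1) * (C * t) ^ k)
        ((C * t) ^ (n + 1) * (1 - C * t)⁻¹) :=
      (hasSum_geometric_of_lt_one hCt0 (by linarith)).mul_left _
    have h2 := tsum_of_norm_bounded (f := fun k => c (k + 1 + n) * t ^ (k + 1 + n)) h1
      (fun k => by
        refine (hbd _).trans (le_of_eq ?_)
        rw [← pow_add]
        congr 1
        ring)
    have h3 : (1 - C * t)⁻¹ ≤ 2 := by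
      rw [inv_le_comm₀ (by linarith) (by norm_num)]
      linarith
    rw [zero_add, add_sub_cancel_left]
    refine h2.trans ?_
    rw [mul_comm]
    exact mul_le_mul_of_nonneg_right h3 (by positivity)
  induction n using Nat.strong_induction_on with
  | _ n ih =>
  rw [Metric.tendsto_nhds]
  intro ε hε
  have hsmall : ∀ᶠ t : ℝ in 𝓝[>] 0, 0 < t ∧ C * t ≤ 1 / 2 ∧ 4 * C ^ (n + 1) * t < ε / 2 := by
    have e1 : ∀ᶠ t : ℝ in 𝓝[>] 0, 0 < t := self_mem_nhdsWithin
    have e2 : Tendsto (fun t : ℝ => C * t) (𝓝[>] 0) (𝓝 (C * 0)) :=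
      (Continuous.tendsto (by fun_prop) 0).mono_left nhdsWithin_le_nhds
    have e3 : Tendsto (fun t : ℝ => 4 * C ^ (n + 1) * t) (𝓝[>] 0) (𝓝 (4 * C ^ (n + 1) * 0)) :=
      (Continuous.tendsto (by fun_prop) 0).mono_left nhdsWithin_le_nhds
    filter_upwards [e1, e2.eventually_le_const (u := 1 / 2) (by norm_num),
      e3.eventually_lt_const (u := ε / 2) (by simpa using hε)] with t h1 h2 h3
    exact ⟨h1, h2, h3⟩
  obtain ⟨t, hlim, ht, hCt, hε'⟩ := (h.and_eventually hsmall).exists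
  -- Removing the first `n` terms, whose limits are known, leaves `a m n * t ^ n + O(t ^ (n + 1))`.
  have hhead : Tendsto (fun m => ∑ k ∈ Finset.range n, a m k * t ^ k) atTop
      (𝓝 (∑ k ∈ Finset.range n, b k * t ^ k)) :=
    tendsto_finsetSum _ fun k hk => (ih k (Finset.mem_range.1 hk)).mul_const _
  have hdiff := hlim.sub hhead
  have hpos : 0 < ε / 2 * t ^ n := by positivity
  filter_upwards [ha, (Metric.tendsto_nhds.1 hdiff) _ hpos] with m hm hclose
  obtain ⟨sa, ta⟩ := hsum t ht hCt (a m) hm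
  obtain ⟨sb, tb⟩ := hsum t ht hCt b hb
  rw [← sa.sum_add_tsum_nat_add n, ← sb.sum_add_tsum_nat_add n, add_sub_cancel_left,
    add_sub_cancel_left, Real.dist_eq] at hclose
  have hA := ta n
  have hB := tb n
  have hlt : |(a m n - b n) * t ^ n| < ε * t ^ n := by
    have e : 4 * (C * t) ^ (n + 1) < ε / 2 * t ^ n := by
      have := mul_lt_mul_of_pos_right hε' (pow_pos ht n)
      calc 4 * (C * t) ^ (n + 1) = 4 * C ^ (n + 1) * t * t ^ n := by ring
        _ < _ := this
    rw [abs_lt] at hclose ⊢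
    rw [abs_le] at hA hB
    constructor <;> nlinarith [hclose.1, hclose.2, hA.1, hA.2, hB.1, hB.2]
  rw [abs_mul, abs_of_pos (pow_pos ht n)] at hlt
  rw [Real.dist_eq]
  exact lt_of_mul_lt_mul_right hlt (pow_pos ht n).le

/-! ### Spectral measures -/

open CompactlySupported in
/-- Spectral measures of bounded selfadjoint operators at a unit vector, seen on the line. The
positive functional `f ↦ ⟨ξ, f(T) ξ⟩` on the continuous functions on the spectrum is represented
by the Riesz–Markov–Kakutani theorem. -/
lemma exists_spectral_measure {E : Type*} [NormedAddCommGroup E] [InnerProductSpace ℂ E]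
    [CompleteSpace E] (T : E →L[ℂ] E) (hT : IsSelfAdjoint T) (ξ : E) (hξ : ‖ξ‖ = 1) :
    ∃ ρ : Measure ℝ, IsProbabilityMeasure ρ ∧ ∀ n : ℕ, Integrable (fun x : ℝ => x ^ n) ρ ∧
      ((∫ x, x ^ n ∂ρ : ℝ) : ℂ) = inner ℂ ξ ((T ^ n) ξ) := by
  let Λ₀ : C_c(spectrum ℝ T, ℝ) →ₗ[ℝ] ℝ :=
    { toFun := fun f => (inner ℂ ξ (cfcHom (R := ℝ) hT f.toContinuousMap ξ)).re
      map_add' := by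
        intro f g
        have : (f + g).toContinuousMap = f.toContinuousMap + g.toContinuousMap := rfl
        rw [this, map_add]
        simp
      map_smul' := by
        intro c f
        have : (c • f).toContinuousMap = c • f.toContinuousMap := rfl
        rw [this, map_smul]
        simp [inner_smul_right_eq_smul] }
  have hΛ₀ : ∀ f, 0 ≤ f → 0 ≤ Λ₀ f := by
    intro f hf
    change 0 ≤ (inner ℂ ξ (cfcHom (R := ℝ) hT f.toContinuousMap ξ)).re
    -- A nonnegative function is a square `g * g`, so the value is `‖g(T) ξ‖ ^ 2`.
    let g : C(spectrum ℝ T, ℝ) := ⟨fun x => Real.sqrt (f x), by fun_prop⟩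
    have hg : f.toContinuousMap = star g * g := by
      ext x
      exact (Real.mul_self_sqrt (hf x)).symm
    rw [hg, map_mul, map_star, mul_apply_eq_comp, ContinuousLinearMap.star_eq_adjoint,
      ContinuousLinearMap.adjoint_inner_right]
    exact inner_self_nonneg (𝕜 := ℂ)
  let Λ : C_c(spectrum ℝ T, ℝ) →ₚ[ℝ] ℝ := PositiveLinearMap.mk₀ Λ₀ hΛ₀
  let ρ₀ := RealRMK.rieszMeasure Λ
  have hint : ∀ n : ℕ, ∫ x, (x : ℝ) ^ n ∂ρ₀ = (inner ℂ ξ ((T ^ n) ξ)).re := by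
    intro n
    let f : C_c(spectrum ℝ T, ℝ) :=
      ⟨(ContinuousMap.restrict (spectrum ℝ T) (ContinuousMap.id ℝ)) ^ n,
        HasCompactSupport.of_compactSpace _⟩
    have h1 : ∫ x, f x ∂ρ₀ = Λ f := RealRMK.integral_rieszMeasure Λ f
    have h2 : Λ f = (inner ℂ ξ (cfcHom (R := ℝ) hT
        ((ContinuousMap.restrict (spectrum ℝ T) (ContinuousMap.id ℝ)) ^ n) ξ)).re := rfl
    rw [map_pow, cfcHom_id hT] at h2
    exact h1.trans h2
  have hfin : IsFiniteMeasure ρ₀ := by infer_instance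
  have hprob : IsProbabilityMeasure ρ₀ := by
    have h0 := hint 0
    simp only [pow_zero, integral_const, smul_eq_mul, mul_one, one_apply_eq_self] at h0
    rw [inner_self_eq_norm_sq_to_K, hξ] at h0
    refine ⟨?_⟩
    have : ρ₀.real Set.univ = 1 := by simpa using h0
    rwa [measureReal_def, ENNReal.toReal_eq_one_iff] at this
  have hmeas : Measurable (Subtype.val : spectrum ℝ T → ℝ) := measurable_subtype_coe
  refine ⟨ρ₀.map Subtype.val, Measure.isProbabilityMeasure_map hmeas.aemeasurable, fun n => ?_⟩
  constructor
  · rw [integrable_map_measure (by fun_prop) hmeas.aemeasurable]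
    obtain ⟨B, hB⟩ := isCompact_univ.exists_bound_of_continuousOn
      (f := (fun x : ℝ => x ^ n) ∘ (Subtype.val : spectrum ℝ T → ℝ)) (by fun_prop)
    exact Integrable.of_bound (by fun_prop) B (ae_of_all _ fun x => hB x (Set.mem_univ x))
  · rw [integral_map hmeas.aemeasurable (by fun_prop), hint n]
    have hs : IsSelfAdjoint (T ^ n) := hT.pow n
    have hsym := hs.isSymmetric ξ ξ
    refine Complex.conj_eq_iff_re.1 ?_
    rw [inner_conj_symm]
    exact hsym

/-! ### The normalized sums in coordinates -/

/-- The normalized sum as an operator on the coordinates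
`w = [i_k, …, i_1] ↦ ⟨(√m) ^ k • e_{i_k} ⊗ ⋯ ⊗ e_{i_1}, x⟩`, extended to all functions of lists.
Only its values at weakly monotone words with letters below `m` matter. -/
def walkStep (l : ℝ) (m : ℕ) : (List ℕ → ℝ) →ₗ[ℝ] (List ℕ → ℝ) where
  toFun f
    | [] => (m : ℝ)⁻¹ * ∑ k ∈ Finset.range m, f [k]
    | i :: w => l * f (i :: w) + f w + (m : ℝ)⁻¹ * ∑ k ∈ Finset.Ico i m, f (k :: i :: w)
  map_add' f g := by
    funext w
    cases w with
    | nil => simp [Finset.sum_add_distrib, mul_add]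
    | cons i w =>
      simp only [Pi.add_apply, Finset.sum_add_distrib]
      ring
  map_smul' c f := by
    funext w
    cases w with
    | nil =>
      simp only [Pi.smul_apply, smul_eq_mul, ← Finset.mul_sum, RingHom.id_apply]
      ring
    | cons i w =>
      simp only [Pi.smul_apply, smul_eq_mul, ← Finset.mul_sum, RingHom.id_apply]
      ring

lemma walkStep_nil (l : ℝ) (m : ℕ) (f : List ℕ → ℝ) :
    walkStep l m f [] = (m : ℝ)⁻¹ * ∑ k ∈ Finset.range m, f [k] := rfl

lemma walkStep_cons (l : ℝ) (m : ℕ) (f : List ℕ → ℝ) (i : ℕ) (w : List ℕ) :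
    walkStep l m f (i :: w)
      = l * f (i :: w) + f w + (m : ℝ)⁻¹ * ∑ k ∈ Finset.Ico i m, f (k :: i :: w) := rfl

/-- `walkStep l m` has norm at most `l + 2` for the supremum norm. -/
lemma abs_walkStep_le {l : ℝ} (hl : 0 ≤ l) {m : ℕ} {f : List ℕ → ℝ} {B : ℝ}
    (hB : ∀ w, |f w| ≤ B) (w : List ℕ) : |walkStep l m f w| ≤ (l + 2) * B := by
  have hB0 : 0 ≤ B := (abs_nonneg _).trans (hB [])
  have avg : ∀ (s : Finset ℕ) (g : ℕ → List ℕ), s.card ≤ m →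
      |(m : ℝ)⁻¹ * ∑ k ∈ s, f (g k)| ≤ B := by
    intro s g hs
    rw [abs_mul, abs_of_nonneg (inv_nonneg.2 (Nat.cast_nonneg m))]
    have h1 : |∑ k ∈ s, f (g k)| ≤ m * B := by
      refine (Finset.abs_sum_le_sum_abs _ _).trans
        ((Finset.sum_le_sum fun k _ => hB (g k)).trans ?_)
      rw [Finset.sum_const, nsmul_eq_mul]
      exact mul_le_mul_of_nonneg_right (by exact_mod_cast hs) hB0
    rcases Nat.eq_zero_or_pos m with rfl | hm
    · simpa using hB0
    · rw [inv_mul_le_iff₀ (by exact_mod_cast hm)]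
      exact h1
  cases w with
  | nil =>
    rw [walkStep_nil]
    refine (avg _ _ (by simp)).trans ?_
    nlinarith
  | cons i w =>
    rw [walkStep_cons]
    have h1 := avg (Finset.Ico i m) (fun k => k :: i :: w) (by simp)
    have h2 : |l * f (i :: w)| ≤ l * B := by
      rw [abs_mul, abs_of_nonneg hl]
      exact mul_le_mul_of_nonneg_left (hB _) hl
    calc _ ≤ |l * f (i :: w)| + |f w| + _ := abs_add_three _ _ _
      _ ≤ l * B + B + B := add_le_add (add_le_add h2 (hB w)) h1
      _ = (l + 2) * B := by ring

/-- The indicator function of the empty list. -/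
def emptyDelta : List ℕ → ℝ
  | [] => 1
  | _ :: _ => 0

lemma abs_walkStep_pow_le {l : ℝ} (hl : 0 ≤ l) {m : ℕ} {f : List ℕ → ℝ} {B : ℝ}
    (hB : ∀ w, |f w| ≤ B) (n : ℕ) (w : List ℕ) :
    |(walkStep l m ^ n) f w| ≤ (l + 2) ^ n * B := by
  induction n generalizing w with
  | zero => simpa using hB w
  | succ n ih =>
    rw [pow_succ' (walkStep l m), Module.End.mul_apply, pow_succ', mul_assoc]
    exact abs_walkStep_le hl ih w

/-- The vacuum moments of the normalized sum, see `inner_vacuum_normalizedSum_pow`. -/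
def walkMoment (l : ℝ) (m n : ℕ) : ℝ := (walkStep l m ^ n) emptyDelta []

lemma abs_walkMoment_le {l : ℝ} (hl : 0 ≤ l) (m n : ℕ) : |walkMoment l m n| ≤ (l + 2) ^ n := by
  have h : ∀ w, |emptyDelta w| ≤ 1 := by
    intro w
    cases w <;> simp [emptyDelta]
  simpa [walkMoment] using abs_walkStep_pow_le hl (m := m) h n []

section

variable {H : Type*} [NormedAddCommGroup H] [InnerProductSpace ℂ H]

lemma isSelfAdjoint_smul_sum_add_smul_sum {E : Type*} [NormedAddCommGroup E]
    [InnerProductSpace ℂ E] [CompleteSpace E] (A : ℕ → E →L[ℂ] E) (r s : ℝ) (t : Finset ℕ) :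
    IsSelfAdjoint ((r : ℂ) • (∑ i ∈ t, (A i + ContinuousLinearMap.adjoint (A i))
      + (s : ℂ) • ∑ i ∈ t, ContinuousLinearMap.adjoint (A i) * A i)) := by
  have hreal : ∀ r : ℝ, IsSelfAdjoint (r : ℂ) := fun r => Complex.conj_ofReal r
  have h1 : IsSelfAdjoint (∑ i ∈ t, (A i + ContinuousLinearMap.adjoint (A i))) :=
    isSelfAdjoint_sum _ fun i _ => IsSelfAdjoint.add_star_self (A i)
  have h2 : IsSelfAdjoint (∑ i ∈ t, ContinuousLinearMap.adjoint (A i) * A i) :=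
    isSelfAdjoint_sum _ fun i _ => IsSelfAdjoint.star_mul_self (A i)
  exact (hreal r).smul (h1.add ((hreal s).smul h2))

lemma isSelfAdjoint_normalizedSum (e : HilbertBasis ℕ ℂ H) (l : ℝ) (m : ℕ) :
    IsSelfAdjoint (normalizedSum e l m) :=
  isSelfAdjoint_smul_sum_add_smul_sum (annihil e) _ _ _

lemma inner_smul_sum_add_sum_left {E : Type*} [NormedAddCommGroup E] [InnerProductSpace ℂ E]
    (r s : ℝ) (t : Finset ℕ) (a b c : ℕ → E) (x : E) :
    inner ℂ ((r : ℂ) • (∑ i ∈ t, a i + ∑ i ∈ t, b i) + (s : ℂ) • ∑ i ∈ t, c i) x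
      = (r : ℂ) * (∑ i ∈ t, inner ℂ (a i) x + ∑ i ∈ t, inner ℂ (b i) x)
        + (s : ℂ) * ∑ i ∈ t, inner ℂ (c i) x := by
  simp only [inner_add_left, inner_smul_left, sum_inner, Complex.conj_ofReal]

lemma normalizedSum_apply (e : HilbertBasis ℕ ℂ H) (l : ℝ) {m : ℕ} (hm : 1 ≤ m) (x : Space e) :
    normalizedSum e l m x = (((Real.sqrt m)⁻¹ : ℝ) : ℂ) • (∑ i ∈ Finset.range m, annihil e i x
      + ∑ i ∈ Finset.range m, creat e i x)
      + (l : ℂ) • ∑ i ∈ Finset.range m, creat e i (annihil e i x) := by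
  have h0 : Real.sqrt m ≠ 0 := (Real.sqrt_pos.2 (by exact_mod_cast hm)).ne'
  have h1 : (((Real.sqrt m)⁻¹ : ℝ) : ℂ) * ((l * Real.sqrt m : ℝ) : ℂ) = (l : ℂ) := by
    rw [← Complex.ofReal_mul]
    congr 1
    field_simp
  simp only [normalizedSum, gauss, preserv, smul_apply,
    add_apply, sum_apply, smul_add, smul_smul, h1,
    mul_apply_eq_comp, Finset.sum_add_distrib]

/-- The coordinates of `Tⁿ Ω` at the generators are the `n`-fold iterate of `walkStep`, up to the
powers of `√m` that rescale the generators. -/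
lemma inner_gen_normalizedSum_pow (e : HilbertBasis ℕ ℂ H) (l : ℝ) {m : ℕ} (hm : 1 ≤ m) (n : ℕ)
    (w : Word) (hw : ∀ i ∈ w.1, i < m) :
    inner ℂ (gen e w) ((normalizedSum e l m ^ n) (vacuum e))
      = (((walkStep l m ^ n) emptyDelta w.1 * ((Real.sqrt m)⁻¹) ^ w.1.length : ℝ) : ℂ) := by
  classical
  have hq : (Real.sqrt m)⁻¹ * (Real.sqrt m)⁻¹ = (m : ℝ)⁻¹ := by
    rw [← mul_inv, Real.mul_self_sqrt (Nat.cast_nonneg m)]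
  induction n generalizing w with
  | zero =>
    rw [pow_zero, pow_zero, one_apply_eq_self, Module.End.one_apply, vacuum,
      orthonormal_iff_ite.mp (orthonormal_gen e)]
    obtain ⟨w, hw'⟩ := w
    cases w <;> simp [emptyDelta]
  | succ n ih =>
    rw [pow_succ' (normalizedSum e l m), pow_succ' (walkStep l m),
      mul_apply_eq_comp, Module.End.mul_apply]
    set x := (normalizedSum e l m ^ n) (vacuum e) with hx
    set b := (walkStep l m ^ n) emptyDelta with hb
    have hsym : inner ℂ (gen e w) (normalizedSum e l m x)
        = inner ℂ (normalizedSum e l m (gen e w)) x :=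
      ((isSelfAdjoint_normalizedSum e l m).isSymmetric _ _).symm
    rw [hsym, normalizedSum_apply e l hm]
    refine (inner_smul_sum_add_sum_left _ _ _ _ _ _ _).trans ?_
    have hcreat : ∀ k < m, inner ℂ (creat e k (gen e w)) x
        = (((if (k :: w.1).Pairwise (· ≥ ·) then b (k :: w.1) else 0)
            * (Real.sqrt m)⁻¹ ^ (w.1.length + 1) : ℝ) : ℂ) := by
      intro k hk
      rw [creat_gen]
      by_cases h : (k :: w.1).Pairwise (· ≥ ·)
      · rw [dif_pos h, if_pos h, ih ⟨k :: w.1, h⟩]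
        · simp
        · intro i hi
          rcases List.mem_cons.1 hi with rfl | hi
          exacts [hk, hw i hi]
      · rw [dif_neg h, if_neg h]
        simp
    rw [Finset.sum_congr rfl fun k hk => hcreat k (Finset.mem_range.1 hk)]
    rw [← Complex.ofReal_sum, ← Finset.sum_mul]
    obtain ⟨w, hw'⟩ := w
    cases w with
    | nil =>
      have h0 : ∀ i, annihil e i (gen e ⟨[], hw'⟩) = 0 := annihil_vacuum e
      simp only [h0, map_zero, inner_zero_left, Finset.sum_const_zero, mul_zero, add_zero, zero_add]
      rw [← Complex.ofReal_mul]
      congr 1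
      simp only [List.pairwise_singleton, if_true, walkStep_nil, List.length_nil, ← hq]
      ring
    | cons j w =>
      have hj : j ∈ Finset.range m := Finset.mem_range.2 (hw j (by simp))
      have hann : ∑ i ∈ Finset.range m, inner ℂ (annihil e i (gen e ⟨j :: w, hw'⟩)) x
          = ((b w * (Real.sqrt m)⁻¹ ^ w.length : ℝ) : ℂ) := by
        rw [Finset.sum_eq_single_of_mem j hj]
        · rw [annihil_cons, if_pos rfl]
          exact ih ⟨w, hw'.of_cons⟩ fun i hi => hw i (List.mem_cons_of_mem _ hi)
        · intro i _ hij
          rw [annihil_cons, if_neg hij, inner_zero_left]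
      have hpres : ∑ i ∈ Finset.range m, inner ℂ (creat e i (annihil e i (gen e ⟨j :: w, hw'⟩))) x
          = ((b (j :: w) * (Real.sqrt m)⁻¹ ^ (w.length + 1) : ℝ) : ℂ) := by
        rw [Finset.sum_eq_single_of_mem j hj]
        · rw [annihil_cons, if_pos rfl, creat_gen, dif_pos hw']
          exact ih ⟨j :: w, hw'⟩ hw
        · intro i _ hij
          rw [annihil_cons, if_neg hij, map_zero, inner_zero_left]
      rw [hann, hpres]
      have hfilter : (∑ k ∈ Finset.range m,
          if (k :: j :: w).Pairwise (· ≥ ·) then b (k :: j :: w) else 0)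
          = ∑ k ∈ Finset.Ico j m, b (k :: j :: w) := by
        rw [← Finset.sum_filter]
        refine Finset.sum_congr ?_ fun _ _ => rfl
        ext k
        simp only [Finset.mem_filter, Finset.mem_range, Finset.mem_Ico]
        refine ⟨fun h => ⟨(List.pairwise_cons.1 h.2).1 j (by simp), h.1⟩, fun h => ⟨h.2, ?_⟩⟩
        refine List.pairwise_cons.2 ⟨fun i hi => ?_, hw'⟩
        rcases List.mem_cons.1 hi with rfl | hi
        · exact h.1
        · exact ((List.pairwise_cons.1 hw').1 i hi).trans h.1
      rw [hfilter, walkStep_cons]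
      rw [← Complex.ofReal_add, ← Complex.ofReal_mul, ← Complex.ofReal_mul, ← Complex.ofReal_add]
      congr 1
      rw [← hq]
      simp only [List.length_cons]
      ring

lemma inner_vacuum_normalizedSum_pow (e : HilbertBasis ℕ ℂ H) (l : ℝ) {m : ℕ} (hm : 1 ≤ m)
    (n : ℕ) : inner ℂ (vacuum e) ((normalizedSum e l m ^ n) (vacuum e))
      = ((walkMoment l m n : ℝ) : ℂ) := by
  have := inner_gen_normalizedSum_pow e l hm n ⟨[], List.Pairwise.nil⟩ (by simp)
  rwa [List.length_nil, pow_zero, mul_one] at this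

end

/-! ### The resolvent at the vacuum -/

/-- The denominators of the resolvent of `walkStep l m` with step `c = t² / m`: an implicit Euler
scheme `d (j + 1) = d j - c / d (j + 1)`, solved by the larger root of a quadratic equation. -/
def denom (d₀ c : ℝ) : ℕ → ℝ
  | 0 => d₀
  | j + 1 => (denom d₀ c j + Real.sqrt (denom d₀ c j ^ 2 - 4 * c)) / 2

lemma denom_succ_ge {d c : ℝ} (hc : 0 ≤ c) (hd : 1 / 2 + 2 * c ≤ d) (hc' : c ≤ 1 / 16) :
    d - 2 * c ≤ (d + Real.sqrt (d ^ 2 - 4 * c)) / 2 ∧ 0 ≤ d ^ 2 - 4 * c := by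
  have h : d - 4 * c ≤ Real.sqrt (d ^ 2 - 4 * c) := by
    apply Real.le_sqrt_of_sq_le
    nlinarith
  exact ⟨by linarith, by nlinarith⟩

lemma denom_ge {d₀ c : ℝ} (hc : 0 ≤ c) (hc' : c ≤ 1 / 16) {m : ℕ} (h : 1 / 2 + 2 * m * c ≤ d₀)
    (j : ℕ) (hj : j ≤ m) : d₀ - 2 * j * c ≤ denom d₀ c j := by
  induction j with
  | zero => simp [denom]
  | succ j ih =>
    have h1 := ih (by omega)
    have h2 : ((j : ℝ) + 1) * c ≤ m * c :=
      mul_le_mul_of_nonneg_right (by exact_mod_cast hj) hc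
    have h3 := (denom_succ_ge hc (d := denom d₀ c j) (by linarith) hc').1
    rw [denom]
    push_cast
    linarith

lemma half_le_denom {d₀ c : ℝ} (hc : 0 ≤ c) (hc' : c ≤ 1 / 16) {m : ℕ}
    (h : 1 / 2 + 2 * m * c ≤ d₀) {j : ℕ} (hj : j ≤ m) : 1 / 2 ≤ denom d₀ c j := by
  have h1 := denom_ge hc hc' h j hj
  have h2 : (j : ℝ) * c ≤ m * c := mul_le_mul_of_nonneg_right (by exact_mod_cast hj) hc
  linarith

lemma denom_step {d₀ c : ℝ} (hc : 0 ≤ c) (hc' : c ≤ 1 / 16) {m : ℕ}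
    (h : 1 / 2 + 2 * m * c ≤ d₀) {j : ℕ} (hj : j < m) :
    denom d₀ c j - denom d₀ c (j + 1) = c * (denom d₀ c (j + 1))⁻¹ := by
  have h1 := denom_ge hc hc' h j hj.le
  have h2 : ((j : ℝ) + 1) * c ≤ m * c :=
    mul_le_mul_of_nonneg_right (by exact_mod_cast hj) hc
  have h3 := (denom_succ_ge hc (d := denom d₀ c j) (by linarith) hc').2
  have h4 := half_le_denom hc hc' h (j := j + 1) hj
  rw [← div_eq_mul_inv, eq_div_iff (by linarith)]
  have h5 := Real.sq_sqrt h3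
  simp only [denom]
  linear_combination (-1 / 4) * h5

lemma sum_inv_denom {d₀ c : ℝ} (hc : 0 ≤ c) (hc' : c ≤ 1 / 16) {m : ℕ}
    (h : 1 / 2 + 2 * m * c ≤ d₀) {j : ℕ} (hj : j ≤ m) :
    c * ∑ k ∈ Finset.range j, (denom d₀ c (k + 1))⁻¹ = d₀ - denom d₀ c j := by
  have htel : ∑ k ∈ Finset.range j, (denom d₀ c k - denom d₀ c (k + 1)) = d₀ - denom d₀ c j :=
    Finset.sum_range_sub' (denom d₀ c) j
  rw [Finset.mul_sum, ← htel]
  exact Finset.sum_congr rfl fun k hk =>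
    (denom_step hc hc' h ((Finset.mem_range.1 hk).trans_le hj)).symm

/-- The squares of the denominators decrease by `2 c` up to an error of order `c ^ 2`. -/
lemma abs_denom_sq_sub_le {d₀ c : ℝ} (hc : 0 ≤ c) (hc' : c ≤ 1 / 16) {m : ℕ}
    (h : 1 / 2 + 2 * m * c ≤ d₀) (j : ℕ) (hj : j ≤ m) :
    |denom d₀ c j ^ 2 - (d₀ ^ 2 - 2 * j * c)| ≤ 4 * j * c ^ 2 := by
  induction j with
  | zero => simp [denom]
  | succ j ih =>
    have h1 := ih (by omega)
    have h2 := denom_step hc hc' h (j := j) hj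
    have h3 := half_le_denom hc hc' h (j := j + 1) hj
    set d := denom d₀ c j
    set d' := denom d₀ c (j + 1)
    have h4 : (d'⁻¹) ^ 2 ≤ 4 := by
      have : d'⁻¹ ≤ 2 := by
        rw [inv_le_comm₀ (by linarith) (by norm_num)]
        linarith
      have h0 : 0 ≤ d'⁻¹ := inv_nonneg.2 (by linarith)
      nlinarith
    have h5 : d' * d'⁻¹ = 1 := mul_inv_cancel₀ (by linarith)
    have h6 : d ^ 2 = d' ^ 2 + 2 * c + c ^ 2 * d'⁻¹ ^ 2 := by
      have : d = d' + c * d'⁻¹ := by linarith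
      rw [this]
      linear_combination (2 * c) * h5
    rw [abs_le] at h1 ⊢
    push_cast
    have h7 : c ^ 2 * d'⁻¹ ^ 2 ≤ c ^ 2 * 4 := mul_le_mul_of_nonneg_left h4 (sq_nonneg c)
    have h8 : 0 ≤ c ^ 2 * d'⁻¹ ^ 2 := by positivity
    constructor <;> nlinarith [h1.1, h1.2]

/-- The coordinates of the resolvent `(1 - t • walkStep l m)⁻¹` applied to the indicator of
the empty list. Words are built letter by letter, and the letter `i` contributes a factor that
depends only on the number `m - i` of letters that may be put on top of it. -/
def resolventCoord (l t : ℝ) (m : ℕ) : List ℕ → ℝ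
  | [] => (denom (1 - l * t) (t ^ 2 / m) m + l * t)⁻¹
  | i :: w => t * (denom (1 - l * t) (t ^ 2 / m) (m - i))⁻¹ * resolventCoord l t m w

/-- `t` is so small that all the denominators are at least `1 / 2`. -/
def IsSmall (l t : ℝ) : Prop := 0 ≤ t ∧ 2 * (l + 2) * t ≤ 1 / 2

lemma IsSmall.bounds {l t : ℝ} (hl : 0 ≤ l) (ht : IsSmall l t) {m : ℕ} (hm : 1 ≤ m) :
    0 ≤ t ^ 2 / m ∧ t ^ 2 / m ≤ 1 / 16 ∧ 1 / 2 + 2 * m * (t ^ 2 / m) ≤ 1 - l * t := by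
  obtain ⟨h0, h1⟩ := ht
  have hm' : (1 : ℝ) ≤ m := by exact_mod_cast hm
  have ht' : t ≤ 1 / 8 := by nlinarith
  refine ⟨by positivity, ?_, ?_⟩
  · refine (div_le_self (sq_nonneg t) hm').trans ?_
    nlinarith
  · have : 2 * (m : ℝ) * (t ^ 2 / m) = 2 * t ^ 2 := by field_simp
    rw [this]
    nlinarith

lemma sum_Ico_denom {l t : ℝ} (hl : 0 ≤ l) (ht : IsSmall l t) {m : ℕ} (hm : 1 ≤ m) (i : ℕ) :
    t ^ 2 / m * ∑ k ∈ Finset.Ico i m, (denom (1 - l * t) (t ^ 2 / m) (m - k))⁻¹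
      = (1 - l * t) - denom (1 - l * t) (t ^ 2 / m) (m - i) := by
  obtain ⟨h1, h2, h3⟩ := ht.bounds hl hm
  rw [← sum_inv_denom h1 h2 h3 (Nat.sub_le m i)]
  congr 1
  rw [Finset.sum_Ico_eq_sum_range, ← Finset.sum_range_reflect]
  refine Finset.sum_congr rfl fun k hk => ?_
  have := Finset.mem_range.1 hk
  congr 2
  omega

lemma resolventCoord_eq {l t : ℝ} (hl : 0 ≤ l) (ht : IsSmall l t) {m : ℕ} (hm : 1 ≤ m) :
    resolventCoord l t m = emptyDelta + t • walkStep l m (resolventCoord l t m) := by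
  obtain ⟨h1, h2, h3⟩ := ht.bounds hl hm
  funext w
  cases w with
  | nil =>
    have hd := half_le_denom h1 h2 h3 le_rfl
    have hs := sum_Ico_denom hl ht hm 0
    have h0 : 0 ≤ l * t := mul_nonneg hl ht.1
    simp only [Pi.add_apply, Pi.smul_apply, smul_eq_mul, walkStep_nil, emptyDelta, resolventCoord]
    rw [← Finset.sum_mul, ← Finset.mul_sum]
    rw [Nat.Ico_zero_eq_range, Nat.sub_zero] at hs
    set D := denom (1 - l * t) (t ^ 2 / m) m
    generalize ∑ k ∈ Finset.range m, (denom (1 - l * t) (t ^ 2 / m) (m - k))⁻¹ = S at hs ⊢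
    have hne : D + l * t ≠ 0 := by linarith
    have e := mul_inv_cancel₀ hne
    rw [div_eq_mul_inv] at hs
    linear_combination e - (D + l * t)⁻¹ * hs
  | cons i w =>
    have hd := half_le_denom h1 h2 h3 (Nat.sub_le m i)
    have hs := sum_Ico_denom hl ht hm i
    simp only [Pi.add_apply, Pi.smul_apply, smul_eq_mul, walkStep_cons, emptyDelta, resolventCoord]
    rw [← Finset.sum_mul, ← Finset.mul_sum]
    set D := denom (1 - l * t) (t ^ 2 / m) (m - i)
    generalize ∑ k ∈ Finset.Ico i m, (denom (1 - l * t) (t ^ 2 / m) (m - k))⁻¹ = S at hs ⊢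
    have e := mul_inv_cancel₀ (show D ≠ 0 by linarith)
    rw [div_eq_mul_inv] at hs
    linear_combination t * resolventCoord l t m w * e
      - t * D⁻¹ * resolventCoord l t m w * hs

lemma abs_resolventCoord_le {l t : ℝ} (hl : 0 ≤ l) (ht : IsSmall l t) {m : ℕ} (hm : 1 ≤ m)
    (w : List ℕ) : |resolventCoord l t m w| ≤ 2 := by
  obtain ⟨h1, h2, h3⟩ := ht.bounds hl hm
  have inv_le : ∀ x : ℝ, 1 / 2 ≤ x → |x⁻¹| ≤ 2 := by
    intro x hx
    rw [abs_of_nonneg (inv_nonneg.2 (by linarith)), inv_le_comm₀ (by linarith) (by norm_num)]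
    linarith
  induction w with
  | nil =>
    have hd := half_le_denom h1 h2 h3 le_rfl
    have h0 : 0 ≤ l * t := mul_nonneg hl ht.1
    exact inv_le _ (by linarith)
  | cons i w ih =>
    have hd := inv_le _ (half_le_denom h1 h2 h3 (Nat.sub_le m i))
    have ht' : |t| ≤ 1 / 2 := by
      rw [abs_of_nonneg ht.1]
      nlinarith [ht.1, ht.2]
    rw [resolventCoord, abs_mul, abs_mul]
    have h4 := mul_le_mul ht' hd (abs_nonneg _) (by norm_num)
    have h5 := mul_le_mul h4 ih (abs_nonneg _) (by norm_num)
    linarith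

/-- The generating function of the moments of the normalized sum. -/
lemma hasSum_walkMoment {l t : ℝ} (hl : 0 ≤ l) (ht : IsSmall l t) {m : ℕ} (hm : 1 ≤ m) :
    HasSum (fun n => walkMoment l m n * t ^ n)
      (denom (1 - l * t) (t ^ 2 / m) m + l * t)⁻¹ := by
  have hlt : (l + 2) * t < 1 := by linarith [ht.2]
  have h0 : 0 ≤ (l + 2) * t := mul_nonneg (by linarith) ht.1
  have hsum : Summable (fun n => walkMoment l m n * t ^ n) := by
    refine Summable.of_norm_bounded (summable_geometric_of_lt_one h0 hlt) fun n => ?_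
    rw [Real.norm_eq_abs, abs_mul, abs_of_nonneg (pow_nonneg ht.1 n), mul_pow]
    exact mul_le_mul_of_nonneg_right (abs_walkMoment_le hl m n) (pow_nonneg ht.1 n)
  -- The remainder of the Neumann series after `N` terms is `t ^ N • walkStep ^ N` of the resolvent.
  have hrem : ∀ N : ℕ, resolventCoord l t m
      = ∑ n ∈ Finset.range N, t ^ n • (walkStep l m ^ n) emptyDelta
        + t ^ N • (walkStep l m ^ N) (resolventCoord l t m) := by
    intro N
    induction N with
    | zero => simp
    | succ N ih =>
      rw [Finset.sum_range_succ, pow_succ (walkStep l m), Module.End.mul_apply, pow_succ t,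
        mul_smul, add_assoc, ← smul_add, ← map_smul, ← map_add, ← resolventCoord_eq hl ht hm]
      exact ih
  have hdiff : ∀ N : ℕ, |∑ n ∈ Finset.range N, walkMoment l m n * t ^ n
      - resolventCoord l t m []| ≤ ((l + 2) * t) ^ N * 2 := by
    intro N
    have h := congrFun (hrem N) []
    simp only [Pi.add_apply, Finset.sum_apply, Pi.smul_apply, smul_eq_mul] at h
    have h' : ∑ n ∈ Finset.range N, walkMoment l m n * t ^ n - resolventCoord l t m []
        = -(t ^ N * (walkStep l m ^ N) (resolventCoord l t m) []) := by
      rw [h, Finset.sum_congr rfl fun n _ => mul_comm (walkMoment l m n) (t ^ n)]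
      simp only [walkMoment]
      ring
    rw [h', abs_neg, abs_mul, abs_of_nonneg (pow_nonneg ht.1 N), mul_pow]
    have := abs_walkStep_pow_le hl (m := m) (abs_resolventCoord_le hl ht hm) N []
    calc _ ≤ t ^ N * ((l + 2) ^ N * 2) := mul_le_mul_of_nonneg_left this (pow_nonneg ht.1 N)
      _ = _ := by ring
  have hlim : Tendsto (fun N => ∑ n ∈ Finset.range N, walkMoment l m n * t ^ n) atTop
      (𝓝 (resolventCoord l t m [])) := by
    rw [tendsto_iff_norm_sub_tendsto_zero]
    refine squeeze_zero (fun _ => norm_nonneg _) hdiff ?_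
    simpa using (tendsto_pow_atTop_nhds_zero_of_lt_one h0 hlt).mul_const 2
  have := hsum.hasSum
  rwa [tendsto_nhds_unique this.tendsto_sum_nat hlim] at this

/-- In the limit the Euler scheme becomes `D ^ 2 = (1 - l t) ^ 2 - 2 t ^ 2`. -/
lemma tendsto_tsum_walkMoment {l t : ℝ} (hl : 0 ≤ l) (ht : IsSmall l t) :
    Tendsto (fun m => ∑' n, walkMoment l m n * t ^ n) atTop
      (𝓝 (Real.sqrt ((1 - l * t) ^ 2 - 2 * t ^ 2) + l * t)⁻¹) := by
  have hsq : Tendsto (fun m : ℕ => denom (1 - l * t) (t ^ 2 / m) m ^ 2) atTop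
      (𝓝 ((1 - l * t) ^ 2 - 2 * t ^ 2)) := by
    rw [tendsto_iff_norm_sub_tendsto_zero]
    refine squeeze_zero' (Eventually.of_forall fun _ => norm_nonneg _) ?_
      (tendsto_const_div_atTop_nhds_zero_nat (4 * t ^ 4))
    filter_upwards [eventually_ge_atTop 1] with m hm
    obtain ⟨h1, h2, h3⟩ := ht.bounds hl hm
    have hm' : (m : ℝ) ≠ 0 := by exact_mod_cast (by omega : m ≠ 0)
    have h := abs_denom_sq_sub_le h1 h2 h3 m le_rfl
    have e1 : 2 * (m : ℝ) * (t ^ 2 / m) = 2 * t ^ 2 := by field_simp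
    have e2 : 4 * (m : ℝ) * (t ^ 2 / m) ^ 2 = 4 * t ^ 4 / m := by field_simp
    rwa [e1, e2] at h
  have hd : Tendsto (fun m : ℕ => denom (1 - l * t) (t ^ 2 / m) m) atTop
      (𝓝 (Real.sqrt ((1 - l * t) ^ 2 - 2 * t ^ 2))) := by
    refine Tendsto.congr' ?_ ((Real.continuous_sqrt.tendsto _).comp hsq)
    filter_upwards [eventually_ge_atTop 1] with m hm
    obtain ⟨h1, h2, h3⟩ := ht.bounds hl hm
    exact Real.sqrt_sq (by linarith [half_le_denom h1 h2 h3 le_rfl])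
  have hpos : Real.sqrt ((1 - l * t) ^ 2 - 2 * t ^ 2) + l * t ≠ 0 := by
    have hge : 1 / 2 ≤ Real.sqrt ((1 - l * t) ^ 2 - 2 * t ^ 2) := by
      refine ge_of_tendsto hd ?_
      filter_upwards [eventually_ge_atTop 1] with m hm
      obtain ⟨h1, h2, h3⟩ := ht.bounds hl hm
      exact half_le_denom h1 h2 h3 le_rfl
    have := mul_nonneg hl ht.1
    linarith
  refine Tendsto.congr' ?_ ((hd.add_const (l * t)).inv₀ hpos)
  filter_upwards [eventually_ge_atTop 1] with m hm
  exact (hasSum_walkMoment hl ht hm).tsum_eq.symm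

/-! ### Meixner polynomials and linear functionals -/

lemma meixnerPoly_add_two (a b c α : ℝ) (n : ℕ) :
    meixnerPoly a b c α (n + 2) = (Polynomial.X - Polynomial.C a) * meixnerPoly a b c α (n + 1)
      - Polynomial.C b * meixnerPoly a b c α n := rfl

lemma natDegree_meixnerPoly_le (a b c α : ℝ) :
    ∀ n : ℕ, (meixnerPoly a b c α n).natDegree ≤ n
  | 0 => by simp [meixnerPoly]
  | 1 => by simp [meixnerPoly]
  | n + 2 => by
    rw [meixnerPoly_add_two]
    refine (Polynomial.natDegree_sub_le _ _).trans (max_le ?_ ?_)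
    · refine Polynomial.natDegree_mul_le.trans ?_
      have := natDegree_meixnerPoly_le a b c α (n + 1)
      rw [Polynomial.natDegree_X_sub_C]
      omega
    · refine (Polynomial.natDegree_C_mul_le _ _).trans ?_
      have := natDegree_meixnerPoly_le a b c α n
      omega

lemma span_meixnerPoly (a b α : ℝ) {c : ℝ} (hc : c ≠ 0) :
    Submodule.span ℝ (Set.range (meixnerPoly a b c α)) = ⊤ := by
  set V := Submodule.span ℝ (Set.range (meixnerPoly a b c α)) with hV
  have hP : ∀ n, meixnerPoly a b c α n ∈ V := fun n => Submodule.subset_span ⟨n, rfl⟩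
  have hX : ∀ p ∈ V, Polynomial.X * p ∈ V := by
    intro p hp
    induction hp using Submodule.span_induction with
    | mem p hp =>
      obtain ⟨n, rfl⟩ := hp
      cases n with
      | zero =>
        have : Polynomial.X * meixnerPoly a b c α 0
            = c • meixnerPoly a b c α 1 + α • meixnerPoly a b c α 0 := by
          simp only [meixnerPoly, Polynomial.smul_eq_C_mul]
          ring
        rw [this]
        exact V.add_mem (V.smul_mem _ (hP 1)) (V.smul_mem _ (hP 0))
      | succ n =>
        have : Polynomial.X * meixnerPoly a b c α (n + 1) = meixnerPoly a b c α (n + 2)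
            + a • meixnerPoly a b c α (n + 1) + b • meixnerPoly a b c α n := by
          rw [meixnerPoly_add_two, Polynomial.smul_eq_C_mul, Polynomial.smul_eq_C_mul]
          ring
        rw [this]
        exact V.add_mem (V.add_mem (hP _) (V.smul_mem _ (hP _))) (V.smul_mem _ (hP _))
    | zero => simp
    | add p q _ _ hp hq =>
      rw [mul_add]
      exact V.add_mem hp hq
    | smul r p _ hp =>
      rw [mul_smul_comm]
      exact V.smul_mem _ hp
  have hpow : ∀ n : ℕ, (Polynomial.X : Polynomial ℝ) ^ n ∈ V := by
    intro n
    induction n with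
    | zero =>
      have : (Polynomial.X : Polynomial ℝ) ^ 0 = c⁻¹ • meixnerPoly a b c α 0 := by
        rw [meixnerPoly, Polynomial.smul_eq_C_mul, ← Polynomial.C_mul, inv_mul_cancel₀ hc]
        simp
      rw [this]
      exact V.smul_mem _ (hP 0)
    | succ n ih =>
      rw [pow_succ']
      exact hX _ ih
  rw [eq_top_iff]
  intro p _
  rw [p.as_sum_range_C_mul_X_pow]
  refine V.sum_mem fun k _ => ?_
  rw [← Polynomial.smul_eq_C_mul]
  exact V.smul_mem _ (hpow k)

/-- A functional that vanishes at `P_n` for all `n ≥ 1` makes the whole system orthogonal: by the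
three-term recurrence `X P_n` is a combination of `P_{n+1}`, `P_n` and `P_{n-1}`. -/
lemma functional_meixnerPoly_mul {a b c α : ℝ} {L : Polynomial ℝ →ₗ[ℝ] ℝ}
    (hL : ∀ n : ℕ, 1 ≤ n → L (meixnerPoly a b c α n) = 0) {m n : ℕ} (hmn : m ≠ n) :
    L (meixnerPoly a b c α m * meixnerPoly a b c α n) = 0 := by
  have hpow : ∀ k n : ℕ, k < n → L (Polynomial.X ^ k * meixnerPoly a b c α n) = 0 := by
    intro k
    induction k with
    | zero =>
      intro n hn
      rw [pow_zero, one_mul]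
      exact hL n hn
    | succ k ih =>
      intro n hn
      obtain ⟨j, rfl⟩ : ∃ j, n = j + 1 := ⟨n - 1, by omega⟩
      have : Polynomial.X ^ (k + 1) * meixnerPoly a b c α (j + 1)
          = Polynomial.X ^ k * meixnerPoly a b c α (j + 2)
            + a • (Polynomial.X ^ k * meixnerPoly a b c α (j + 1))
            + b • (Polynomial.X ^ k * meixnerPoly a b c α j) := by
        rw [meixnerPoly_add_two, Polynomial.smul_eq_C_mul, Polynomial.smul_eq_C_mul]
        ring
      rw [this, map_add, map_add, map_smul, map_smul, ih _ (by omega), ih _ (by omega),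
        ih _ (by omega)]
      simp
  have hlt : ∀ m n : ℕ, m < n → L (meixnerPoly a b c α m * meixnerPoly a b c α n) = 0 := by
    intro m n h
    rw [(meixnerPoly a b c α m).as_sum_range_C_mul_X_pow, Finset.sum_mul, map_sum]
    refine Finset.sum_eq_zero fun k hk => ?_
    have hk' := natDegree_meixnerPoly_le a b c α m
    have hk'' := Finset.mem_range.1 hk
    rw [mul_assoc, ← Polynomial.smul_eq_C_mul, map_smul, hpow k n (by omega), smul_zero]
  rcases lt_or_gt_of_ne hmn with h | h
  · exact hlt m n h
  · rw [mul_comm]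
    exact hlt n m h

lemma integrable_eval {ρ : Measure ℝ} (hi : ∀ n : ℕ, Integrable (fun x : ℝ => x ^ n) ρ)
    (p : Polynomial ℝ) : Integrable (fun x => p.eval x) ρ := by
  simp_rw [Polynomial.eval_eq_sum_range]
  exact integrable_finsetSum _ fun k _ => (hi k).const_mul _

/-- Integration of polynomials against a measure with finite moments. -/
def polyIntegral (ρ : Measure ℝ) (hi : ∀ n : ℕ, Integrable (fun x : ℝ => x ^ n) ρ) :
    Polynomial ℝ →ₗ[ℝ] ℝ where
  toFun p := ∫ x, p.eval x ∂ρ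
  map_add' p q := by
    simp_rw [Polynomial.eval_add]
    exact integral_add (integrable_eval hi p) (integrable_eval hi q)
  map_smul' r p := by
    simp_rw [Polynomial.eval_smul, smul_eq_mul]
    exact integral_const_mul _ _

lemma isFreeMeixnerLaw_of_integral_eq_zero {a b c α : ℝ} {ρ : Measure ℝ} [IsProbabilityMeasure ρ]
    (hi : ∀ n : ℕ, Integrable (fun x : ℝ => x ^ n) ρ)
    (h : ∀ n : ℕ, 1 ≤ n → ∫ x, (meixnerPoly a b c α n).eval x ∂ρ = 0) :
    IsFreeMeixnerLaw a b c α ρ := by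
  refine ⟨inferInstance, hi, h, fun m n hmn => ?_⟩
  have := functional_meixnerPoly_mul (L := polyIntegral ρ hi) h hmn
  simpa [polyIntegral] using this

lemma moments_eq_of_isFreeMeixnerLaw {a b c α : ℝ} (hc : c ≠ 0) {ρ σ : Measure ℝ}
    (hρ : IsFreeMeixnerLaw a b c α ρ) (hσ : IsFreeMeixnerLaw a b c α σ) (n : ℕ) :
    ∫ x, x ^ n ∂ρ = ∫ x, x ^ n ∂σ := by
  obtain ⟨_, hiρ, hρ', _⟩ := hρ
  obtain ⟨_, hiσ, hσ', _⟩ := hσ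
  have hext : polyIntegral ρ hiρ = polyIntegral σ hiσ := by
    refine LinearMap.ext_on_range (span_meixnerPoly a b α hc) fun k => ?_
    cases k with
    | zero => simp [polyIntegral, meixnerPoly]
    | succ k => exact (hρ' (k + 1) (by omega)).trans (hσ' (k + 1) (by omega)).symm
  simpa [polyIntegral] using LinearMap.congr_fun hext (Polynomial.X ^ n)

/-! ### Generating functions -/

lemma hasSum_integral_of_geometric_bound {ρ : Measure ℝ} [IsProbabilityMeasure ρ]
    {F : ℕ → ℝ → ℝ} {f : ℝ → ℝ} {B q : ℝ} (hq : 0 ≤ q) (hq' : q < 1) (hF : ∀ n, Continuous (F n))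
    (hb : ∀ᵐ x ∂ρ, ∀ n, |F n x| ≤ B * q ^ n) (hf : ∀ᵐ x ∂ρ, HasSum (fun n => F n x) (f x)) :
    HasSum (fun n => ∫ x, F n x ∂ρ) (∫ x, f x ∂ρ) := by
  refine hasSum_integral_of_dominated_convergence (fun n _ => B * q ^ n)
    (fun n => (hF n).aestronglyMeasurable) (fun n => ?_)
    (ae_of_all _ fun _ => (summable_geometric_of_lt_one hq hq').mul_left B)
    (integrable_const _) hf
  filter_upwards [hb] with x hx using hx n

lemma abs_meixnerPoly_eval_le {l x : ℝ} (hl : 0 ≤ l) (hx : |x| ≤ l + 2) :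
    ∀ n : ℕ, |(meixnerPoly l (1 / 2) 2 0 n).eval x| ≤ 2 * (2 * l + 3) ^ n
  | 0 => by simp [meixnerPoly]
  | 1 => by
    simp only [meixnerPoly, map_zero, sub_zero, Polynomial.eval_X, pow_one]
    linarith
  | n + 2 => by
    have h1 := abs_meixnerPoly_eval_le hl hx (n + 1)
    have h0 := abs_meixnerPoly_eval_le hl hx n
    have hxl : |x - l| ≤ 2 * l + 2 := by
      rw [abs_le] at hx ⊢
      constructor <;> linarith [hx.1, hx.2]
    rw [meixnerPoly_add_two]
    simp only [Polynomial.eval_sub, Polynomial.eval_mul, Polynomial.eval_X, Polynomial.eval_C]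
    set p := (meixnerPoly l (1 / 2) 2 0 (n + 1)).eval x
    set q := (meixnerPoly l (1 / 2) 2 0 n).eval x
    have h2 : |(x - l) * p| ≤ (2 * l + 2) * (2 * (2 * l + 3) ^ (n + 1)) := by
      rw [abs_mul]
      exact mul_le_mul hxl h1 (abs_nonneg _) (by linarith)
    have h3 : |1 / 2 * q| ≤ 1 / 2 * (2 * (2 * l + 3) ^ n) := by
      rw [abs_mul, abs_of_pos (by norm_num : (0 : ℝ) < 1 / 2)]
      linarith
    have h4 : 0 ≤ (2 * l + 3) ^ n := by positivity
    calc _ ≤ |(x - l) * p| + |1 / 2 * q| := abs_sub _ _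
      _ ≤ _ := add_le_add h2 h3
      _ ≤ 2 * (2 * l + 3) ^ (n + 2) := by
        have e1 : (2 * l + 3) ^ (n + 1) = (2 * l + 3) ^ n * (2 * l + 3) := pow_succ _ _
        have e2 : (2 * l + 3) ^ (n + 2) = (2 * l + 3) ^ n * (2 * l + 3) * (2 * l + 3) := by ring
        rw [e1, e2]
        nlinarith [mul_nonneg hl h4]

/-- In the variable `s` with `t = s / (1 + l s + s² / 2)`, the generating function of the Meixner
polynomials is an affine function of the geometric series `1 / (1 - t x)`. -/
lemma hasSum_meixnerPoly {l x s : ℝ} (hl : 0 ≤ l) (hx : |x| ≤ l + 2) (hs : 0 ≤ s)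
    (hs' : (2 * l + 3) * s ≤ 1 / 2) :
    HasSum (fun n => (meixnerPoly l (1 / 2) 2 0 n).eval x * s ^ n)
      (1 + (1 + l * s - s ^ 2 / 2) / (1 + l * s + s ^ 2 / 2)
        * (1 - s / (1 + l * s + s ^ 2 / 2) * x)⁻¹) := by
  set p : ℕ → ℝ := fun n => (meixnerPoly l (1 / 2) 2 0 n).eval x * s ^ n with hp
  have hq : 0 ≤ (2 * l + 3) * s := by positivity
  have hsum : Summable p := by
    refine Summable.of_norm_bounded
      ((summable_geometric_of_lt_one hq (by linarith)).mul_left 2) fun n => ?_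
    rw [Real.norm_eq_abs, hp, abs_mul, abs_of_nonneg (pow_nonneg hs n), mul_pow, ← mul_assoc]
    exact mul_le_mul_of_nonneg_right (abs_meixnerPoly_eval_le hl hx n) (pow_nonneg hs n)
  have hrec : ∀ n, p (n + 2) = (x - l) * s * p (n + 1) - s ^ 2 / 2 * p n := by
    intro n
    simp only [hp, meixnerPoly_add_two, Polynomial.eval_sub, Polynomial.eval_mul,
      Polynomial.eval_X, Polynomial.eval_C]
    ring
  have hp0 : p 0 = 2 := by simp [hp, meixnerPoly]
  have hp1 : p 1 = x * s := by simp [hp, meixnerPoly]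
  have hsum1 := (summable_nat_add_iff 1).2 hsum
  have e1 : ∑' n, p n = 2 + ∑' n, p (n + 1) := by rw [hsum.tsum_eq_zero_add, hp0]
  have e2 : ∑' n, p (n + 1) = x * s + ∑' n, p (n + 2) := by
    rw [hsum1.tsum_eq_zero_add, zero_add, hp1]
  have e3 : ∑' n, p (n + 2) = (x - l) * s * ∑' n, p (n + 1) - s ^ 2 / 2 * ∑' n, p n := by
    simp_rw [hrec]
    rw [(hsum1.mul_left _).tsum_sub (hsum.mul_left _), tsum_mul_left, tsum_mul_left]
  have hk : 1 ≤ 1 + l * s + s ^ 2 / 2 := by nlinarith [mul_nonneg hl hs]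
  have hxs : x * s ≤ 1 / 2 := by
    have h1 : x * s ≤ (l + 2) * s := mul_le_mul_of_nonneg_right ((le_abs_self x).trans hx) hs
    have h2 := mul_nonneg hl hs
    nlinarith
  have hne : 1 + l * s + s ^ 2 / 2 - s * x ≠ 0 := by
    have : 0 < 1 + l * s + s ^ 2 / 2 - s * x := by nlinarith
    exact this.ne'
  have hk0 : 1 + l * s + s ^ 2 / 2 ≠ 0 := by linarith
  have hinv : (1 - s / (1 + l * s + s ^ 2 / 2) * x)⁻¹
      = (1 + l * s + s ^ 2 / 2) / (1 + l * s + s ^ 2 / 2 - s * x) := by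
    rw [eq_div_iff hne, inv_mul_eq_iff_eq_mul₀]
    · field_simp
    · intro h
      apply hne
      field_simp at h
      linarith
  have : ∑' n, p n = 1 + (1 + l * s - s ^ 2 / 2) / (1 + l * s + s ^ 2 / 2)
      * (1 - s / (1 + l * s + s ^ 2 / 2) * x)⁻¹ := by
    rw [hinv, div_mul_div_cancel₀ hk0]
    have e4 : (∑' n, p n) * (1 + l * s + s ^ 2 / 2 - s * x)
        = 2 + 2 * l * s - s * x := by
      rw [e3] at e2
      have : ∑' n, p (n + 1) = ∑' n, p n - 2 := by linarith
      rw [this] at e2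
      linear_combination e2
    rw [← sub_eq_iff_eq_add', eq_div_iff hne]
    linear_combination e4
  rw [← this]
  exact hsum.hasSum

/-- The generating function of the moments of a free Meixner law carried by
`[-(l + 2), l + 2]`. -/
lemma tsum_moments_of_isFreeMeixnerLaw {l s : ℝ} {ρ : Measure ℝ} (hl : 0 ≤ l)
    (hρ : IsFreeMeixnerLaw l (1 / 2) 2 0 ρ) (hsupp : ∀ᵐ x ∂ρ, |x| ≤ l + 2) (hs : 0 ≤ s)
    (hs' : (2 * l + 3) * s ≤ 1 / 2) :
    ∑' n, (∫ x, x ^ n ∂ρ) * (s / (1 + l * s + s ^ 2 / 2)) ^ n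
      = (1 + l * s + s ^ 2 / 2) / (1 + l * s - s ^ 2 / 2) := by
  obtain ⟨_, hi, h0, -⟩ := hρ
  have hls := mul_nonneg hl hs
  have hs1 : s ≤ 1 / 2 := by nlinarith
  have hk : 1 ≤ 1 + l * s + s ^ 2 / 2 := by nlinarith
  have hk' : 0 < 1 + l * s - s ^ 2 / 2 := by nlinarith
  set κ := 1 + l * s + s ^ 2 / 2 with hκ
  have ht0 : 0 ≤ s / κ := by positivity
  have hts : s / κ ≤ s := div_le_self hs hk
  set t := s / κ with ht
  have hq : 0 ≤ (l + 2) * t := by positivity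
  have hq1 : (l + 2) * t < 1 := by
    have : (l + 2) * t ≤ (l + 2) * s := mul_le_mul_of_nonneg_left hts (by linarith)
    nlinarith
  have hxt : ∀ x : ℝ, |x| ≤ l + 2 → |t * x| ≤ (l + 2) * t := by
    intro x hx
    rw [abs_mul, abs_of_nonneg ht0, mul_comm]
    exact mul_le_mul_of_nonneg_right hx ht0
  have hgeom : HasSum (fun n => ∫ x, (t * x) ^ n ∂ρ) (∫ x, (1 - t * x)⁻¹ ∂ρ) := by
    refine hasSum_integral_of_geometric_bound (B := 1) hq hq1 (fun n => by fun_prop) ?_ ?_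
    · filter_upwards [hsupp] with x hx n
      rw [abs_pow, one_mul]
      exact pow_le_pow_left₀ (abs_nonneg _) (hxt x hx) n
    · filter_upwards [hsupp] with x hx
      exact hasSum_geometric_of_norm_lt_one ((hxt x hx).trans_lt hq1)
  have hmeix : HasSum (fun n => ∫ x, (meixnerPoly l (1 / 2) 2 0 n).eval x * s ^ n ∂ρ)
      (∫ x, (1 + (1 + l * s - s ^ 2 / 2) / κ * (1 - t * x)⁻¹) ∂ρ) := by
    have hqs : 0 ≤ (2 * l + 3) * s := by positivity
    refine hasSum_integral_of_geometric_bound (B := 2) hqs (by linarith)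
      (fun n => (Polynomial.continuous _).mul continuous_const) ?_ ?_
    · filter_upwards [hsupp] with x hx n
      rw [abs_mul, abs_of_nonneg (pow_nonneg hs n), mul_pow, ← mul_assoc]
      exact mul_le_mul_of_nonneg_right (abs_meixnerPoly_eval_le hl hx n) (pow_nonneg hs n)
    · filter_upwards [hsupp] with x hx
      exact hasSum_meixnerPoly hl hx hs hs'
  -- Only the constant polynomial contributes.
  have htwo : HasSum (fun n => ∫ x, (meixnerPoly l (1 / 2) 2 0 n).eval x * s ^ n ∂ρ) 2 := by
    have h2 : ∫ x, (meixnerPoly l (1 / 2) 2 0 0).eval x * s ^ 0 ∂ρ = 2 := by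
      simp [meixnerPoly]
    have := hasSum_single
      (f := fun n => ∫ x, (meixnerPoly l (1 / 2) 2 0 n).eval x * s ^ n ∂ρ) 0 (fun n hn => by
      rw [integral_mul_const, h0 n (by omega), zero_mul])
    rwa [h2] at this
  have hint : Integrable (fun x => (1 - t * x)⁻¹) ρ := by
    refine Integrable.of_bound (C := (1 - (l + 2) * t)⁻¹) ?_ ?_
    · exact (by fun_prop : Measurable fun x : ℝ => (1 - t * x)⁻¹).aestronglyMeasurable
    · filter_upwards [hsupp] with x hx
      have h1 := (abs_le.1 (hxt x hx)).2
      rw [Real.norm_eq_abs, abs_of_nonneg (inv_nonneg.2 (by linarith))]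
      exact inv_anti₀ (by linarith) (by linarith)
  have heq := hmeix.unique htwo
  rw [integral_add (integrable_const _) (hint.const_mul _), integral_const_mul] at heq
  simp only [integral_const, probReal_univ, smul_eq_mul, mul_one] at heq
  have hfin : ∫ x, (1 - t * x)⁻¹ ∂ρ = κ / (1 + l * s - s ^ 2 / 2) := by
    have h1 : (1 + l * s - s ^ 2 / 2) / κ * ∫ x, (1 - t * x)⁻¹ ∂ρ = 1 := by linarith
    have hκ0 : κ ≠ 0 := by linarith
    rw [eq_div_iff hk'.ne']
    rw [div_mul_eq_mul_div, div_eq_iff hκ0] at h1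
    linarith
  rw [← hfin, ← hgeom.tsum_eq]
  refine tsum_congr fun n => ?_
  simp_rw [mul_pow, integral_const_mul]
  ring

/-! ### The free Meixner law -/

/-- Cauchy's integral formula on the unit circle, written as an integral over the angle. -/
lemma integral_circleMap_div_sub {g : ℂ → ℂ} {w : ℂ} (hw : ‖w‖ < 1)
    (hg : DifferentiableOn ℂ g (Metric.closedBall 0 1)) :
    ∫ θ : ℝ in 0..2 * Real.pi,
      circleMap 0 1 θ * Complex.I * ((circleMap 0 1 θ - w)⁻¹ * g (circleMap 0 1 θ))
      = 2 * Real.pi * Complex.I * g w := by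
  have h := hg.circleIntegral_sub_inv_smul (w := w) (by simpa using hw)
  simpa only [circleIntegral, deriv_circleMap, smul_eq_mul] using h

lemma circleMap_zero_one (θ : ℝ) :
    circleMap 0 1 θ = Real.cos θ + Real.sin θ * Complex.I := by
  simp [circleMap, Complex.exp_mul_I]

lemma circleMap_zero_one_pow (θ : ℝ) (n : ℕ) :
    circleMap 0 1 θ ^ n = Real.cos (n * θ) + Real.sin (n * θ) * Complex.I := by
  rw [circleMap_zero_one, Complex.ofReal_cos, Complex.ofReal_sin,
    Complex.cos_add_sin_mul_I_pow]
  push_cast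
  rfl

/-- The integrand over the angle as the imaginary part of a rational function of `z = exp (i θ)`:
`z ^ 2 - 1` is `2 i z sin θ`, and `√2 l - 2 i sin θ` is `(1 + √2 l z - z ^ 2) / z`. -/
lemma im_circle_integrand {l : ℝ} (hl : 0 < l) (n : ℕ) (θ : ℝ) :
    (Complex.I * (circleMap 0 1 θ ^ n * (circleMap 0 1 θ ^ 2 - 1)
        / (1 + Real.sqrt 2 * l * circleMap 0 1 θ - circleMap 0 1 θ ^ 2))).im
      = -(Real.sin θ * (Real.sqrt 2 * l * Real.sin (n * θ) + 2 * Real.cos (n * θ) * Real.sin θ)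
          / (l ^ 2 + 2 * Real.sin θ ^ 2)) := by
  have h2 : Real.sqrt 2 ^ 2 = 2 := Real.sq_sqrt (by norm_num)
  have hsc := Real.sin_sq_add_cos_sq θ
  have hden : l ^ 2 + 2 * Real.sin θ ^ 2 ≠ 0 := by positivity
  rw [circleMap_zero_one_pow]
  set z := circleMap 0 1 θ with hz
  have hz' : z = Real.cos θ + Real.sin θ * Complex.I := circleMap_zero_one θ
  set S := Real.sin θ
  set K := Real.cos θ
  set a := Real.sin (n * θ)
  set b := Real.cos (n * θ)
  have hI := Complex.I_sq
  have hscC : (S : ℂ) ^ 2 + (K : ℂ) ^ 2 = 1 := by exact_mod_cast hsc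
  have h2C : ((Real.sqrt 2 : ℝ) : ℂ) ^ 2 = 2 := by exact_mod_cast h2
  have hz1 : z ^ 2 - 1 = 2 * Complex.I * S * z := by
    rw [hz']
    linear_combination hscC - S ^ 2 * hI
  have hz2 : 1 + Real.sqrt 2 * l * z - z ^ 2 = z * (Real.sqrt 2 * l - 2 * Complex.I * S) := by
    linear_combination -hz1
  have hz0 : z ≠ 0 := by
    intro h
    have : ‖z‖ = 1 := by simp [hz]
    rw [h, norm_zero] at this
    exact zero_ne_one this
  have hdC : (l : ℂ) ^ 2 + 2 * (S : ℂ) ^ 2 ≠ 0 := by exact_mod_cast hden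
  have hprod : (Real.sqrt 2 * l - 2 * Complex.I * S) * (Real.sqrt 2 * l + 2 * Complex.I * S)
      = 2 * ((l : ℂ) ^ 2 + 2 * (S : ℂ) ^ 2) := by
    linear_combination (l : ℂ) ^ 2 * h2C - 4 * (S : ℂ) ^ 2 * hI
  have hq0 : (Real.sqrt 2 * l - 2 * Complex.I * S : ℂ) ≠ 0 := by
    intro h
    rw [h, zero_mul] at hprod
    exact hdC (by linear_combination (-1 / 2) * hprod)
  have hmain : Complex.I * ((b + a * Complex.I) * (z ^ 2 - 1)
      / (1 + Real.sqrt 2 * l * z - z ^ 2))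
      = (((S / (l ^ 2 + 2 * S ^ 2) : ℝ) : ℂ)) *
        (((-(Real.sqrt 2 * l * b) + 2 * a * S : ℝ) : ℂ)
          + ((-(Real.sqrt 2 * l * a + 2 * b * S) : ℝ) : ℂ) * Complex.I) := by
    rw [hz2, hz1, mul_div_assoc', div_eq_iff (mul_ne_zero hz0 hq0)]
    push_cast
    rw [div_mul_eq_mul_div, div_mul_eq_mul_div, eq_div_iff hdC]
    linear_combination (2 * S * z * (b + a * Complex.I) * (l ^ 2 + 2 * S ^ 2)
        - 2 * a * S ^ 2 * z * (Real.sqrt 2 * l - 2 * Complex.I * S)) * hI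
      + S * z * (b + a * Complex.I) * hprod
  rw [hmain, Complex.im_ofReal_mul]
  simp only [Complex.add_im, Complex.ofReal_im, Complex.mul_im, Complex.ofReal_re, Complex.I_re,
    Complex.I_im]
  ring

/-- The quadratic relations between the two roots `(l ∓ √(l² + 2)) / √2` of
`z² - √2 l z - 1`. -/
lemma root_relations {l q s r R : ℝ} (hs : s ^ 2 = 2) (hs0 : s ≠ 0) (hq : q ^ 2 = l ^ 2 + 2)
    (hr : r = (l - q) / s) (hR : R = (l + q) / s) :
    r + R = s * l ∧ r * R = -1 ∧ R - r = s * q ∧ r ^ 2 - 1 = s * l * r ∧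
      r ^ 2 = -(s * q) * r - 1 := by
  have h1 : s * r = l - q := by rw [hr]; field_simp
  have h2 : s * R = l + q := by rw [hR]; field_simp
  have key : ∀ x y : ℝ, s * x = s * y → x = y := fun x y h => mul_left_cancel₀ hs0 h
  have key2 : ∀ x y : ℝ, s ^ 2 * x = s ^ 2 * y → x = y := fun x y h =>
    mul_left_cancel₀ (pow_ne_zero 2 hs0) h
  refine ⟨key _ _ (by linear_combination h1 + h2 - l * hs), key2 _ _ ?_,
    key _ _ (by linear_combination h2 - h1 - q * hs), key2 _ _ ?_, key2 _ _ ?_⟩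
  · linear_combination s * R * h1 + (l - q) * h2 + hs - hq
  · linear_combination (s * r + (l - q)) * h1 - hs - s ^ 2 * l * h1 - (l - q) * l * hs + hq
  · linear_combination (s * r + (l - q)) * h1 + hs + s ^ 2 * q * h1 + (l - q) * q * hs - hq

lemma abs_roots {l : ℝ} (hl : 0 < l) :
    |(l - Real.sqrt (l ^ 2 + 2)) / Real.sqrt 2| < 1 ∧
      1 < (l + Real.sqrt (l ^ 2 + 2)) / Real.sqrt 2 := by
  have hs0 : 0 < Real.sqrt 2 := Real.sqrt_pos.2 (by norm_num)
  have hs := Real.sq_sqrt (show (0 : ℝ) ≤ 2 by norm_num)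
  have hq := Real.sq_sqrt (show 0 ≤ l ^ 2 + 2 by positivity)
  have hq0 : 0 < Real.sqrt (l ^ 2 + 2) := Real.sqrt_pos.2 (by positivity)
  set s := Real.sqrt 2
  set q := Real.sqrt (l ^ 2 + 2)
  have h1 : l < q := by nlinarith
  have h2 : q < l + s := by nlinarith
  have h3 : s < q := by nlinarith
  refine ⟨?_, ?_⟩
  · rw [abs_div, abs_of_pos hs0, div_lt_one hs0, abs_lt]
    constructor <;> linarith
  · rw [lt_div_iff₀ hs0]
    linarith

/-- The facts about the roots `r`, `R` of `z² - √2 l z - 1` that the contour integrals need: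
`r` lies inside the unit circle and `R` outside. -/
lemma complex_roots {l : ℝ} (hl : 0 < l) : ∃ r R : ℝ,
    r = (l - Real.sqrt (l ^ 2 + 2)) / Real.sqrt 2 ∧ ‖(r : ℂ)‖ < 1 ∧
      r ^ 2 - 1 = Real.sqrt 2 * l * r ∧
      R - r = Real.sqrt 2 * Real.sqrt (l ^ 2 + 2) ∧
      (∀ z : ℂ, 1 + Real.sqrt 2 * l * z - z ^ 2 = (z - r) * (R - z)) ∧
      (∀ z : ℂ, ‖z‖ ≤ 1 → (R : ℂ) - z ≠ 0) := by
  obtain ⟨h1, h2⟩ := abs_roots hl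
  obtain ⟨e1, e2, e3, e4, -⟩ := root_relations (l := l)
    (Real.sq_sqrt (show (0 : ℝ) ≤ 2 by norm_num)) (by positivity)
    (Real.sq_sqrt (show 0 ≤ l ^ 2 + 2 by positivity)) rfl rfl
  refine ⟨_, _, rfl, ?_, e4, e3, fun z => ?_, fun z hz h => ?_⟩
  · rw [Complex.norm_real]
    exact h1
  · set r := (l - Real.sqrt (l ^ 2 + 2)) / Real.sqrt 2
    set R := (l + Real.sqrt (l ^ 2 + 2)) / Real.sqrt 2
    have c1 : (r : ℂ) + R = Real.sqrt 2 * l := by exact_mod_cast e1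
    have c2 : (r : ℂ) * R = -1 := by exact_mod_cast e2
    linear_combination (-z) * c1 + c2
  · rw [← sub_eq_zero.1 h, Complex.norm_real, Real.norm_eq_abs] at hz
    exact absurd ((le_abs_self _).trans hz) (not_le.2 h2)

lemma circleMap_sub_ne_zero {w : ℂ} (hw : ‖w‖ < 1) (θ : ℝ) : circleMap 0 1 θ - w ≠ 0 := by
  intro h
  have : ‖circleMap 0 1 θ‖ = 1 := by simp
  rw [sub_eq_zero.1 h] at this
  exact hw.ne this

/-- The integral over the circle, evaluated at the pole inside the unit disc. -/
lemma integral_circle_succ {l : ℝ} (hl : 0 < l) (n : ℕ) :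
    ∫ θ : ℝ in 0..2 * Real.pi, Complex.I * (circleMap 0 1 θ ^ (n + 1) * (circleMap 0 1 θ ^ 2 - 1)
        / (1 + Real.sqrt 2 * l * circleMap 0 1 θ - circleMap 0 1 θ ^ 2))
      = ((2 * Real.pi * (((l - Real.sqrt (l ^ 2 + 2)) / Real.sqrt 2) ^ (n + 1)
          * (l / Real.sqrt (l ^ 2 + 2))) : ℝ) : ℂ) * Complex.I := by
  obtain ⟨r, R, hr, hr1, hr2, hRr, hfac, hR⟩ := complex_roots hl
  have hg : DifferentiableOn ℂ (fun z : ℂ => z ^ n * (z ^ 2 - 1) / (R - z))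
      (Metric.closedBall 0 1) := by
    refine DifferentiableOn.div (by fun_prop) (by fun_prop) fun z hz => hR z (by simpa using hz)
  have h := integral_circleMap_div_sub hr1 hg
  have hs0 : Real.sqrt 2 ≠ 0 := by positivity
  have hq0 : Real.sqrt (l ^ 2 + 2) ≠ 0 := by positivity
  have hval : r ^ n * (r ^ 2 - 1) / (R - r) = r ^ (n + 1) * (l / Real.sqrt (l ^ 2 + 2)) := by
    rw [hr2, hRr]
    field_simp
    ring
  rw [← hr, ← hval]
  push_cast
  rw [mul_right_comm, ← h]
  refine intervalIntegral.integral_congr fun θ _ => ?_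
  have hz1 := circleMap_sub_ne_zero hr1 θ
  have hz2 := hR (circleMap 0 1 θ) (by simp)
  simp only [hfac]
  field_simp
  ring

lemma integral_circle_zero {l : ℝ} (hl : 0 < l) :
    ∫ θ : ℝ in 0..2 * Real.pi, Complex.I * (circleMap 0 1 θ ^ 0 * (circleMap 0 1 θ ^ 2 - 1)
        / (1 + Real.sqrt 2 * l * circleMap 0 1 θ - circleMap 0 1 θ ^ 2))
      = ((2 * Real.pi * (l / Real.sqrt (l ^ 2 + 2) - 1) : ℝ) : ℂ) * Complex.I := by
  obtain ⟨r, R, hr, hr1, hr2, hRr, hfac, hR⟩ := complex_roots hl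
  have hg : DifferentiableOn ℂ (fun z : ℂ => (Real.sqrt 2 * l : ℂ) / (R - z))
      (Metric.closedBall 0 1) := by
    refine DifferentiableOn.div (by fun_prop) (by fun_prop) fun z hz => hR z (by simpa using hz)
  have h := integral_circleMap_div_sub hr1 hg
  have hs0 : Real.sqrt 2 ≠ 0 := by positivity
  have hval : Real.sqrt 2 * l / (R - r) = l / Real.sqrt (l ^ 2 + 2) := by
    rw [hRr, mul_div_mul_left _ _ hs0]
  have hcont : Continuous fun θ : ℝ => circleMap 0 1 θ * Complex.I
      * ((circleMap 0 1 θ - r)⁻¹ * ((Real.sqrt 2 * l : ℂ) / (R - circleMap 0 1 θ))) := by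
    have hc : Continuous (circleMap 0 1) := continuous_circleMap 0 1
    refine (hc.mul continuous_const).mul (((hc.sub continuous_const).inv₀
      (circleMap_sub_ne_zero hr1)).mul (continuous_const.div (continuous_const.sub hc) fun θ => ?_))
    exact hR _ (by simp)
  -- Splitting off the pole at the origin leaves a single simple pole in the unit disc.
  have hsplit : ∀ θ : ℝ, Complex.I * (circleMap 0 1 θ ^ 0 * (circleMap 0 1 θ ^ 2 - 1)
        / (1 + Real.sqrt 2 * l * circleMap 0 1 θ - circleMap 0 1 θ ^ 2))
      = circleMap 0 1 θ * Complex.I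
        * ((circleMap 0 1 θ - r)⁻¹ * ((Real.sqrt 2 * l : ℂ) / (R - circleMap 0 1 θ)))
        - Complex.I := by
    intro θ
    have hz1 := circleMap_sub_ne_zero hr1 θ
    have hz2 := hR (circleMap 0 1 θ) (by simp)
    have hf := hfac (circleMap 0 1 θ)
    rw [hf, pow_zero, one_mul, mul_div_assoc', div_eq_iff (mul_ne_zero hz1 hz2), sub_mul]
    have e1 : circleMap 0 1 θ * Complex.I
        * ((circleMap 0 1 θ - r)⁻¹ * ((Real.sqrt 2 * l : ℂ) / (R - circleMap 0 1 θ)))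
        * ((circleMap 0 1 θ - r) * (R - circleMap 0 1 θ))
        = circleMap 0 1 θ * Complex.I * (Real.sqrt 2 * l) := by
      field_simp
    rw [e1, ← hf]
    ring
  simp_rw [hsplit]
  rw [intervalIntegral.integral_sub (hcont.intervalIntegrable _ _)
    (continuous_const.intervalIntegrable _ _), h, intervalIntegral.integral_const]
  rw [← hval]
  push_cast
  simp only [sub_zero, Complex.real_smul]
  push_cast
  ring

/-- The angular integrals behind the moments of the absolutely continuous part. -/
lemma integral_angle {l : ℝ} (hl : 0 < l) (n : ℕ) :
    ∫ θ : ℝ in 0..2 * Real.pi,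
      Real.sin θ * (Real.sqrt 2 * l * Real.sin (n * θ) + 2 * Real.cos (n * θ) * Real.sin θ)
          / (l ^ 2 + 2 * Real.sin θ ^ 2)
      = 2 * Real.pi * ((if n = 0 then 1 else 0)
        - ((l - Real.sqrt (l ^ 2 + 2)) / Real.sqrt 2) ^ n * (l / Real.sqrt (l ^ 2 + 2))) := by
  have hcont : Continuous fun θ : ℝ =>
      Complex.I * (circleMap 0 1 θ ^ n * (circleMap 0 1 θ ^ 2 - 1)
        / (1 + Real.sqrt 2 * l * circleMap 0 1 θ - circleMap 0 1 θ ^ 2)) := by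
    obtain ⟨r, R, -, hr1, -, -, hfac, hR⟩ := complex_roots hl
    have hc : Continuous (circleMap 0 1) := continuous_circleMap 0 1
    refine continuous_const.mul (Continuous.div (by fun_prop) (by fun_prop) fun θ => ?_)
    rw [hfac]
    exact mul_ne_zero (circleMap_sub_ne_zero hr1 θ) (hR _ (by simp))
  have him := Complex.imCLM.intervalIntegral_comp_comm
    (hcont.intervalIntegrable (μ := volume) 0 (2 * Real.pi))
  simp only [Complex.imCLM_apply, im_circle_integrand hl, intervalIntegral.integral_neg] at him
  rw [neg_eq_iff_eq_neg] at him
  rw [him]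
  cases n with
  | zero =>
    rw [integral_circle_zero hl, Complex.im_ofReal_mul]
    simp
    ring
  | succ n =>
    rw [integral_circle_succ hl, Complex.im_ofReal_mul]
    simp

lemma integral_half_angle {l : ℝ} (hl : 0 < l) (n : ℕ) :
    ∫ θ : ℝ in 0..Real.pi,
      Real.sin θ * (Real.sqrt 2 * l * Real.sin (n * θ) + 2 * Real.cos (n * θ) * Real.sin θ)
          / (l ^ 2 + 2 * Real.sin θ ^ 2)
      = Real.pi * ((if n = 0 then 1 else 0)
        - ((l - Real.sqrt (l ^ 2 + 2)) / Real.sqrt 2) ^ n * (l / Real.sqrt (l ^ 2 + 2))) := by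
  set f : ℝ → ℝ := fun θ =>
    Real.sin θ * (Real.sqrt 2 * l * Real.sin (n * θ) + 2 * Real.cos (n * θ) * Real.sin θ)
          / (l ^ 2 + 2 * Real.sin θ ^ 2) with hf
  have hcont : Continuous f := by
    refine Continuous.div (by fun_prop) (by fun_prop) fun θ => ?_
    positivity
  have hsymm : ∀ θ, f (2 * Real.pi - θ) = f θ := by
    intro θ
    have e : (n : ℝ) * (2 * Real.pi - θ) = n * (2 * Real.pi) - n * θ := by ring
    simp only [hf, e, Real.sin_nat_mul_two_pi_sub, Real.cos_nat_mul_two_pi_sub,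
      Real.sin_two_pi_sub]
    ring
  have hsub : ∫ θ in Real.pi..2 * Real.pi, f θ = ∫ θ in 0..Real.pi, f θ := by
    have := intervalIntegral.integral_comp_sub_left (a := 0) (b := Real.pi) f (2 * Real.pi)
    simp only [hsymm] at this
    rw [this]
    congr 1 <;> ring
  have hadd := intervalIntegral.integral_add_adjacent_intervals
    (hcont.intervalIntegrable (μ := volume) 0 Real.pi)
    (hcont.intervalIntegrable (μ := volume) Real.pi (2 * Real.pi))
  rw [hsub] at hadd
  have := integral_angle hl n
  linarith

/-! ### Meixner polynomials at the support of the law -/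

/-- On the interval `x = l + √2 cos θ` the recurrence of the Meixner polynomials is that of
Chebyshev polynomials. -/
lemma meixnerPoly_eval_cos (l θ : ℝ) : ∀ n : ℕ,
    Real.sin θ * (Real.sqrt 2 ^ n
        * (meixnerPoly l (1 / 2) 2 0 n).eval (l + Real.sqrt 2 * Real.cos θ))
      = Real.sqrt 2 * l * Real.sin (n * θ) + 2 * Real.cos (n * θ) * Real.sin θ
  | 0 => by simp [meixnerPoly]; ring
  | 1 => by
    have h2 := Real.sq_sqrt (show (0 : ℝ) ≤ 2 by norm_num)
    simp only [meixnerPoly, map_zero, sub_zero, Polynomial.eval_X, pow_one, Nat.cast_one, one_mul]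
    linear_combination Real.sin θ * Real.cos θ * h2
  | n + 2 => by
    have h2 := Real.sq_sqrt (show (0 : ℝ) ≤ 2 by norm_num)
    have ih1 := meixnerPoly_eval_cos l θ (n + 1)
    have ih0 := meixnerPoly_eval_cos l θ n
    rw [meixnerPoly_add_two]
    simp only [Polynomial.eval_sub, Polynomial.eval_mul, Polynomial.eval_X, Polynomial.eval_C]
    push_cast at ih1 ⊢
    have a1 : ((n : ℝ) + 2) * θ = (n + 1) * θ + θ := by ring
    have a0 : (n : ℝ) * θ = (n + 1) * θ - θ := by ring
    rw [a0, Real.sin_sub, Real.cos_sub] at ih0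
    rw [a1, Real.sin_add, Real.cos_add, pow_succ, pow_succ]
    rw [pow_succ] at ih1
    linear_combination 2 * Real.cos θ * ih1 - ih0 + (Real.sin θ * Real.sqrt 2 ^ n
      * (Real.sqrt 2 * Real.cos θ * (meixnerPoly l (1 / 2) 2 0 (n + 1)).eval
          (l + Real.sqrt 2 * Real.cos θ)
        - 1 / 2 * (meixnerPoly l (1 / 2) 2 0 n).eval (l + Real.sqrt 2 * Real.cos θ))) * h2

/-- At the atom the recurrence has a geometric solution. -/
lemma meixnerPoly_eval_atom (l : ℝ) : ∀ n : ℕ,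
    Real.sqrt 2 ^ n * (meixnerPoly l (1 / 2) 2 0 n).eval (l - Real.sqrt (l ^ 2 + 2))
      = 2 * ((l - Real.sqrt (l ^ 2 + 2)) / Real.sqrt 2) ^ n
  | 0 => by simp [meixnerPoly]
  | 1 => by
    have h2 := Real.sq_sqrt (show (0 : ℝ) ≤ 2 by norm_num)
    have hs0 : Real.sqrt 2 ≠ 0 := by positivity
    simp only [meixnerPoly, map_zero, sub_zero, Polynomial.eval_X, pow_one]
    rw [mul_div_assoc', eq_div_iff hs0]
    linear_combination (l - Real.sqrt (l ^ 2 + 2)) * h2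
  | n + 2 => by
    have h2 := Real.sq_sqrt (show (0 : ℝ) ≤ 2 by norm_num)
    have ih1 := meixnerPoly_eval_atom l (n + 1)
    have ih0 := meixnerPoly_eval_atom l n
    obtain ⟨-, -, -, -, e⟩ := root_relations (l := l) h2 (by positivity)
      (Real.sq_sqrt (show 0 ≤ l ^ 2 + 2 by positivity)) rfl rfl
    rw [meixnerPoly_add_two]
    simp only [Polynomial.eval_sub, Polynomial.eval_mul, Polynomial.eval_X, Polynomial.eval_C]
    set r := (l - Real.sqrt (l ^ 2 + 2)) / Real.sqrt 2
    set q := Real.sqrt (l ^ 2 + 2)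
    rw [pow_succ (Real.sqrt 2)] at ih1
    rw [pow_succ (Real.sqrt 2), pow_succ (Real.sqrt 2)]
    linear_combination (-(q * Real.sqrt 2)) * ih1 - ih0 - 2 * r ^ n * e
      - (1 / 2) * Real.sqrt 2 ^ n * (meixnerPoly l (1 / 2) 2 0 n).eval (l - q) * h2

/-- The density of the absolutely continuous part of the limit law, before truncation. -/
def meixnerDensity (l y : ℝ) : ℝ :=
  Real.sqrt (2 - (y - l) ^ 2) / (Real.pi * (l ^ 2 + 2 - (y - l) ^ 2))

/-- The absolutely continuous part of the limit law. -/
def meixnerAC (l : ℝ) : Measure ℝ :=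
  (volume : Measure ℝ).withDensity (fun x : ℝ => ENNReal.ofReal
    ((Set.Ioo (l - Real.sqrt 2) (l + Real.sqrt 2)).indicator (meixnerDensity l) x))

/-- The limit law. -/
def meixnerMeasure (l : ℝ) : Measure ℝ :=
  ENNReal.ofReal (l / Real.sqrt (l ^ 2 + 2)) • Measure.dirac (l - Real.sqrt (l ^ 2 + 2))
    + meixnerAC l

lemma sq_sub_le_two {l x : ℝ} (hx : x ∈ Set.Icc (l - Real.sqrt 2) (l + Real.sqrt 2)) :
    (x - l) ^ 2 ≤ 2 := by
  have h2 := Real.sq_sqrt (show (0 : ℝ) ≤ 2 by norm_num)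
  rw [← h2]
  exact sq_le_sq' (by linarith [hx.1]) (by linarith [hx.2])

lemma continuousOn_meixnerDensity {l : ℝ} (hl : 0 < l) :
    ContinuousOn (meixnerDensity l) (Set.Icc (l - Real.sqrt 2) (l + Real.sqrt 2)) := by
  unfold meixnerDensity
  refine ContinuousOn.div (by fun_prop) (by fun_prop) fun x hx => ?_
  have := sq_sub_le_two hx
  have : 0 < l ^ 2 + 2 - (x - l) ^ 2 := by nlinarith
  exact (mul_pos Real.pi_pos this).ne'

lemma meixnerDensity_nonneg {l x : ℝ} (hx : x ∈ Set.Icc (l - Real.sqrt 2) (l + Real.sqrt 2)) :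
    0 ≤ meixnerDensity l x := by
  have := sq_sub_le_two hx
  have : 0 ≤ l ^ 2 + 2 - (x - l) ^ 2 := by nlinarith [sq_nonneg l]
  exact div_nonneg (Real.sqrt_nonneg _) (mul_nonneg Real.pi_pos.le this)

lemma measurable_meixnerDensity (l : ℝ) : Measurable (meixnerDensity l) := by
  unfold meixnerDensity
  fun_prop

lemma isFiniteMeasure_meixnerAC {l : ℝ} (hl : 0 < l) : IsFiniteMeasure (meixnerAC l) := by
  refine isFiniteMeasure_withDensity_ofReal (Integrable.hasFiniteIntegral ?_)
  rw [integrable_indicator_iff measurableSet_Ioo]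
  exact ((continuousOn_meixnerDensity hl).integrableOn_compact isCompact_Icc).mono_set
    Set.Ioo_subset_Icc_self

lemma ae_meixnerAC {l : ℝ} (hl : 0 < l) : ∀ᵐ x ∂(meixnerAC l), |x| ≤ l + 2 := by
  have hm := measurable_meixnerDensity l
  rw [meixnerAC, ae_withDensity_iff (hm.indicator measurableSet_Ioo).ennreal_ofReal]
  refine ae_of_all _ fun x hx => ?_
  have hmem : x ∈ Set.Ioo (l - Real.sqrt 2) (l + Real.sqrt 2) := by
    by_contra h
    rw [Set.indicator_of_notMem h, ENNReal.ofReal_zero] at hx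
    exact hx rfl
  have h2 : Real.sqrt 2 ≤ 2 := by
    rw [Real.sqrt_le_left (by norm_num)]
    norm_num
  rw [abs_le]
  constructor <;> linarith [hmem.1, hmem.2]

lemma ae_meixnerMeasure {l : ℝ} (hl : 0 < l) : ∀ᵐ x ∂(meixnerMeasure l), |x| ≤ l + 2 := by
  rw [meixnerMeasure, ae_add_measure_iff]
  refine ⟨Measure.ae_smul_measure ?_ _, ae_meixnerAC hl⟩
  rw [ae_dirac_eq]
  change |l - Real.sqrt (l ^ 2 + 2)| ≤ l + 2
  have h1 : Real.sqrt (l ^ 2 + 2) ≤ l + 2 := by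
    rw [Real.sqrt_le_left (by linarith)]
    nlinarith
  have h2 := Real.sqrt_nonneg (l ^ 2 + 2)
  rw [abs_le]
  constructor <;> linarith

lemma integral_meixnerAC (l : ℝ) (f : ℝ → ℝ) :
    ∫ x, f x ∂(meixnerAC l)
      = ∫ x in (l - Real.sqrt 2)..(l + Real.sqrt 2), meixnerDensity l x * f x := by
  have hm := measurable_meixnerDensity l
  have hs : 0 ≤ Real.sqrt 2 := Real.sqrt_nonneg 2
  rw [meixnerAC, integral_withDensity_eq_integral_toReal_smul
    (hm.indicator measurableSet_Ioo).ennreal_ofReal (ae_of_all _ fun _ => ENNReal.ofReal_lt_top),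
    intervalIntegral.integral_of_le (by linarith), integral_Ioc_eq_integral_Ioo,
    ← integral_indicator measurableSet_Ioo]
  congr 1
  funext x
  by_cases hx : x ∈ Set.Ioo (l - Real.sqrt 2) (l + Real.sqrt 2)
  · rw [Set.indicator_of_mem hx, Set.indicator_of_mem hx, smul_eq_mul,
      ENNReal.toReal_ofReal (meixnerDensity_nonneg (Set.Ioo_subset_Icc_self hx))]
  · rw [Set.indicator_of_notMem hx, Set.indicator_of_notMem hx]
    simp

/-- The substitution `x = l + √2 cos θ`. -/
lemma integral_meixnerAC_eq_angle {l : ℝ} (hl : 0 < l) {f : ℝ → ℝ} (hf : Continuous f) :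
    ∫ x, f x ∂(meixnerAC l) = ∫ θ in 0..Real.pi,
      2 * Real.sin θ ^ 2 / (Real.pi * (l ^ 2 + 2 * Real.sin θ ^ 2))
        * f (l + Real.sqrt 2 * Real.cos θ) := by
  have h2 := Real.sq_sqrt (show (0 : ℝ) ≤ 2 by norm_num)
  have hs : 0 ≤ Real.sqrt 2 := Real.sqrt_nonneg 2
  have himage : (fun θ => l + Real.sqrt 2 * Real.cos θ) '' Set.uIcc 0 Real.pi
      ⊆ Set.Icc (l - Real.sqrt 2) (l + Real.sqrt 2) := by
    rintro _ ⟨θ, -, rfl⟩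
    have h1 := Real.neg_one_le_cos θ
    have h3 := Real.cos_le_one θ
    constructor <;> nlinarith
  have hsubst := intervalIntegral.integral_comp_mul_deriv' (a := 0) (b := Real.pi)
    (f := fun θ => l + Real.sqrt 2 * Real.cos θ) (f' := fun θ => Real.sqrt 2 * -Real.sin θ)
    (g := fun x => meixnerDensity l x * f x)
    (fun θ _ => ((Real.hasDerivAt_cos θ).const_mul _).const_add _) (by fun_prop)
    (((continuousOn_meixnerDensity hl).mul hf.continuousOn).mono himage)
  rw [integral_meixnerAC]
  simp only [Real.cos_zero, Real.cos_pi, mul_one, mul_neg, ← sub_eq_add_neg] at hsubst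
  rw [intervalIntegral.integral_symm, ← hsubst, ← intervalIntegral.integral_neg]
  refine intervalIntegral.integral_congr fun θ hθ => ?_
  rw [Set.uIcc_of_le Real.pi_pos.le] at hθ
  have hsin := Real.sin_nonneg_of_mem_Icc hθ
  have hsc := Real.sin_sq_add_cos_sq θ
  have e1 : (l + Real.sqrt 2 * Real.cos θ - l) ^ 2 = 2 * Real.cos θ ^ 2 := by
    linear_combination Real.cos θ ^ 2 * h2
  have e2 : 2 - 2 * Real.cos θ ^ 2 = (Real.sqrt 2 * Real.sin θ) ^ 2 := by
    linear_combination -2 * hsc - Real.sin θ ^ 2 * h2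
  have e3 : l ^ 2 + 2 - 2 * Real.cos θ ^ 2 = l ^ 2 + 2 * Real.sin θ ^ 2 := by
    linear_combination -2 * hsc
  simp only [Function.comp_apply, meixnerDensity, e1, e3]
  rw [e2, Real.sqrt_sq (mul_nonneg hs hsin)]
  simp only [div_eq_mul_inv]
  linear_combination Real.sin θ ^ 2 * f (l + Real.sqrt 2 * Real.cos θ)
    * (Real.pi * (l ^ 2 + 2 * Real.sin θ ^ 2))⁻¹ * h2

lemma integral_meixnerPoly_meixnerAC {l : ℝ} (hl : 0 < l) (n : ℕ) :
    Real.sqrt 2 ^ n * ∫ x, (meixnerPoly l (1 / 2) 2 0 n).eval x ∂(meixnerAC l)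
      = 2 * ((if n = 0 then 1 else 0)
        - ((l - Real.sqrt (l ^ 2 + 2)) / Real.sqrt 2) ^ n * (l / Real.sqrt (l ^ 2 + 2))) := by
  have hpi := Real.pi_ne_zero
  have h := integral_half_angle hl n
  rw [integral_meixnerAC_eq_angle hl (Polynomial.continuous _),
    ← intervalIntegral.integral_const_mul]
  have h' : ∀ θ : ℝ, Real.sqrt 2 ^ n
      * (2 * Real.sin θ ^ 2 / (Real.pi * (l ^ 2 + 2 * Real.sin θ ^ 2))
        * (meixnerPoly l (1 / 2) 2 0 n).eval (l + Real.sqrt 2 * Real.cos θ))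
      = 2 / Real.pi * (Real.sin θ
        * (Real.sqrt 2 * l * Real.sin (n * θ) + 2 * Real.cos (n * θ) * Real.sin θ)
          / (l ^ 2 + 2 * Real.sin θ ^ 2)) := by
    intro θ
    have hden : l ^ 2 + 2 * Real.sin θ ^ 2 ≠ 0 := by positivity
    rw [← meixnerPoly_eval_cos]
    field_simp
  simp_rw [h']
  rw [intervalIntegral.integral_const_mul, h]
  field_simp

lemma integral_meixnerMeasure {l : ℝ} (hl : 0 < l) {f : ℝ → ℝ} (hf : Continuous f) :
    ∫ x, f x ∂(meixnerMeasure l)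
      = l / Real.sqrt (l ^ 2 + 2) * f (l - Real.sqrt (l ^ 2 + 2)) + ∫ x, f x ∂(meixnerAC l) := by
  have := isFiniteMeasure_meixnerAC hl
  have h0 : 0 ≤ l / Real.sqrt (l ^ 2 + 2) := by positivity
  rw [meixnerMeasure, integral_add_measure, integral_smul_measure, integral_dirac,
    ENNReal.toReal_ofReal h0, smul_eq_mul]
  · exact (integrable_dirac (by simp)).smul_measure ENNReal.ofReal_ne_top
  · exact integrable_of_ae_abs_le (ae_meixnerAC hl) hf

lemma integral_meixnerPoly_meixnerMeasure {l : ℝ} (hl : 0 < l) (n : ℕ) :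
    ∫ x, (meixnerPoly l (1 / 2) 2 0 n).eval x ∂(meixnerMeasure l) = if n = 0 then 2 else 0 := by
  have hs0 : Real.sqrt 2 ^ n ≠ 0 := by positivity
  have h1 := integral_meixnerPoly_meixnerAC hl n
  have h2 := meixnerPoly_eval_atom l n
  rw [integral_meixnerMeasure hl (Polynomial.continuous _)]
  apply mul_left_cancel₀ hs0
  rw [mul_add, h1]
  have h3 : Real.sqrt 2 ^ n * (if n = 0 then 2 else 0) = 2 * (if n = 0 then (1 : ℝ) else 0) := by
    split_ifs with h
    · simp [h]
    · simp
  rw [h3]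
  linear_combination l / Real.sqrt (l ^ 2 + 2) * h2

lemma isProbabilityMeasure_meixnerMeasure {l : ℝ} (hl : 0 < l) :
    IsProbabilityMeasure (meixnerMeasure l) := by
  have h := integral_meixnerPoly_meixnerMeasure hl 0
  simp only [meixnerPoly, Polynomial.eval_C, integral_const, smul_eq_mul, if_true] at h
  have h1 : (meixnerMeasure l).real Set.univ = 1 := by linarith
  exact ⟨by rwa [measureReal_def, ENNReal.toReal_eq_one_iff] at h1⟩

lemma isFreeMeixnerLaw_meixnerMeasure {l : ℝ} (hl : 0 < l) :
    IsFreeMeixnerLaw l (1 / 2) 2 0 (meixnerMeasure l) := by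
  have := isProbabilityMeasure_meixnerMeasure hl
  refine isFreeMeixnerLaw_of_integral_eq_zero
    (fun n => integrable_of_ae_abs_le (ae_meixnerMeasure hl) (by fun_prop)) fun n hn => ?_
  rw [integral_meixnerPoly_meixnerMeasure hl, if_neg (by omega)]

lemma abs_integral_pow_le {ρ : Measure ℝ} [IsProbabilityMeasure ρ] {C : ℝ}
    (h : ∀ᵐ x ∂ρ, |x| ≤ C) (n : ℕ) : |∫ x, x ^ n ∂ρ| ≤ C ^ n := by
  have := norm_integral_le_of_norm_le_const (μ := ρ) (C := C ^ n) (f := fun x => x ^ n) (by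
    filter_upwards [h] with x hx
    rw [norm_pow]
    exact pow_le_pow_left₀ (norm_nonneg x) hx n)
  simpa using this

lemma isFreeMeixnerLaw_iff {l : ℝ} (hl : 0 < l) (ρ : Measure ℝ) :
    IsFreeMeixnerLaw l (1 / 2) 2 0 ρ ↔ ρ = meixnerMeasure l := by
  refine ⟨fun h => ?_, fun h => h ▸ isFreeMeixnerLaw_meixnerMeasure hl⟩
  have hν := isFreeMeixnerLaw_meixnerMeasure hl
  have := h.1
  have := hν.1
  have hm := fun n => moments_eq_of_isFreeMeixnerLaw two_ne_zero h hν n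
  refine eq_of_moments (C := l + 2) (by linarith) h.2.1 hν.2.1 (fun n => ?_) hm
  rw [hm n]
  exact abs_integral_pow_le (ae_meixnerMeasure hl) n

/-! ### Convergence -/

/-- The moments of the normalized sums converge to those of the limit law: with
`t = s / (1 + l s + s² / 2)` both generating functions become rational in `s` and agree. -/
lemma tendsto_walkMoment {l : ℝ} (hl : 0 < l) (n : ℕ) :
    Tendsto (fun m => walkMoment l m n) atTop (𝓝 (∫ x, x ^ n ∂(meixnerMeasure l))) := by
  have := isProbabilityMeasure_meixnerMeasure hl
  refine tendsto_coeff_of_tendsto_sum (b := fun n => ∫ x, x ^ n ∂(meixnerMeasure l))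
    (C := l + 2) (by linarith)
    (Eventually.of_forall fun m => abs_walkMoment_le hl.le m)
    (abs_integral_pow_le (ae_meixnerMeasure hl)) ?_ n
  have hmap : Tendsto (fun s : ℝ => s / (1 + l * s + s ^ 2 / 2)) (𝓝[>] 0) (𝓝[>] 0) := by
    refine tendsto_nhdsWithin_iff.2 ⟨?_, ?_⟩
    · have : ContinuousAt (fun s : ℝ => s / (1 + l * s + s ^ 2 / 2)) 0 :=
        ContinuousAt.div (by fun_prop) (by fun_prop) (by norm_num)
      have h := this.tendsto
      simp only [zero_div] at h
      exact h.mono_left nhdsWithin_le_nhds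
    · filter_upwards [self_mem_nhdsWithin] with s hs
      have hs' : 0 < s := hs
      exact div_pos hs' (by positivity)
  refine hmap.frequently (Eventually.frequently ?_)
  have hsmall : ∀ᶠ s : ℝ in 𝓝[>] 0, (2 * l + 4) * s ≤ 1 / 2 := by
    have : Tendsto (fun s : ℝ => (2 * l + 4) * s) (𝓝[>] 0) (𝓝 ((2 * l + 4) * 0)) :=
      (Continuous.tendsto (by fun_prop) 0).mono_left nhdsWithin_le_nhds
    exact this.eventually_le_const (by norm_num)
  filter_upwards [self_mem_nhdsWithin, hsmall] with s hs0 hs1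
  have hs : 0 < s := hs0
  have hls : 0 ≤ l * s := by positivity
  have hs2 : s ≤ 1 / 8 := by nlinarith
  rw [tsum_moments_of_isFreeMeixnerLaw hl.le (isFreeMeixnerLaw_meixnerMeasure hl)
    (ae_meixnerMeasure hl) hs.le (by linarith)]
  have hk : 1 ≤ 1 + l * s + s ^ 2 / 2 := by nlinarith
  have ht : IsSmall l (s / (1 + l * s + s ^ 2 / 2)) := by
    refine ⟨by positivity, ?_⟩
    have h1 : s / (1 + l * s + s ^ 2 / 2) ≤ s := div_le_self hs.le hk
    have h2 := mul_le_mul_of_nonneg_left h1 (by linarith : 0 ≤ 2 * (l + 2))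
    linarith
  convert tendsto_tsum_walkMoment hl.le ht using 2
  set κ := 1 + l * s + s ^ 2 / 2 with hκ
  have hκ0 : κ ≠ 0 := by linarith
  have hroot : (1 - l * (s / κ)) ^ 2 - 2 * (s / κ) ^ 2 = ((1 - s ^ 2 / 2) / κ) ^ 2 := by
    have : 1 - l * (s / κ) = (1 + s ^ 2 / 2) / κ := by
      rw [eq_div_iff hκ0, sub_mul, mul_assoc, div_mul_cancel₀ _ hκ0, hκ]
      ring
    rw [this, div_pow, div_pow, div_pow]
    ring
  have hnn : 0 ≤ (1 - s ^ 2 / 2) / κ := div_nonneg (by nlinarith) (by linarith)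
  rw [hroot, Real.sqrt_sq hnn, mul_div_assoc', ← add_div, inv_div]
  congr 1
  ring

lemma exists_vacuumLaw {H : Type*} [NormedAddCommGroup H] [InnerProductSpace ℂ H]
    (e : HilbertBasis ℕ ℂ H) (l : ℝ) (m : ℕ) :
    ∃ μ : ProbabilityMeasure ℝ, IsVacuumLaw e (normalizedSum e l m) (μ : Measure ℝ) := by
  obtain ⟨ρ, h1, h2⟩ := exists_spectral_measure _ (isSelfAdjoint_normalizedSum e l m) (vacuum e)
    ((orthonormal_gen e).1 _)
  exact ⟨⟨ρ, h1⟩, h1, h2⟩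

lemma IsVacuumLaw.integral_pow {H : Type*} [NormedAddCommGroup H] [InnerProductSpace ℂ H]
    {e : HilbertBasis ℕ ℂ H} {l : ℝ} {m : ℕ} {ρ : Measure ℝ}
    (h : IsVacuumLaw e (normalizedSum e l m) ρ) (hm : 1 ≤ m) (n : ℕ) :
    ∫ x, x ^ n ∂ρ = walkMoment l m n := by
  have := (h.2 n).2
  rw [inner_vacuum_normalizedSum_pow e l hm] at this
  exact_mod_cast this

end WMFock

end

open WMFock in
theorem theorem4p2 {H : Type*} [NormedAddCommGroup H] [InnerProductSpace ℂ H] [CompleteSpace H]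
    (e : HilbertBasis ℕ ℂ H) (l : ℝ) (hl : 0 < l) :
    ∃ (μ : ℕ → ProbabilityMeasure ℝ) (ν : ProbabilityMeasure ℝ),
      -- `μ m` is the unique vacuum law of the normalized sum of the first `m` operators
      (∀ m : ℕ, 1 ≤ m → ∀ ρ : Measure ℝ,
        WMFock.IsVacuumLaw e (WMFock.normalizedSum e l m) ρ ↔ ρ = (μ m : Measure ℝ)) ∧
      -- `ν` is the unique free Meixner law with parameters `(l, 1/2, 2, 0)`
      (∀ ρ : Measure ℝ,
        WMFock.IsFreeMeixnerLaw l (1 / 2) 2 0 ρ ↔ ρ = (ν : Measure ℝ)) ∧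
      -- its atomic and absolutely continuous parts
      (ν : Measure ℝ) =
        ENNReal.ofReal (l / Real.sqrt (l ^ 2 + 2)) •
            Measure.dirac (l - Real.sqrt (l ^ 2 + 2))
          + (volume : Measure ℝ).withDensity (fun x : ℝ => ENNReal.ofReal
              ((Set.Ioo (l - Real.sqrt 2) (l + Real.sqrt 2)).indicator
                (fun y : ℝ => Real.sqrt (2 - (y - l) ^ 2)
                  / (Real.pi * (l ^ 2 + 2 - (y - l) ^ 2))) x)) ∧
      -- weak convergence
      Tendsto μ atTop (𝓝 ν) := by
  choose μ hμ using exists_vacuumLaw e l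
  have hC : 0 < l + 2 := by linarith
  have hbound : ∀ m, 1 ≤ m → ∀ ρ, IsVacuumLaw e (normalizedSum e l m) ρ →
      ∀ n, |∫ x, x ^ n ∂ρ| ≤ (l + 2) ^ n := fun m hm ρ h n => by
    rw [h.integral_pow hm]
    exact abs_walkMoment_le hl.le m n
  refine ⟨μ, ⟨meixnerMeasure l, isProbabilityMeasure_meixnerMeasure hl⟩, ?_,
    isFreeMeixnerLaw_iff hl, rfl, ?_⟩
  · intro m hm ρ
    refine ⟨fun h => ?_, fun h => h ▸ hμ m⟩
    have := h.1
    refine eq_of_moments hC (fun n => (h.2 n).1) (fun n => ((hμ m).2 n).1) (hbound m hm ρ h)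
      fun n => ?_
    rw [h.integral_pow hm, (hμ m).integral_pow hm]
  · refine tendsto_of_moments (C := l + 2) ?_ (ae_meixnerMeasure hl) fun n => ?_
    · filter_upwards [eventually_ge_atTop 1] with m hm
      exact ae_abs_le_of_moments hC (fun n => ((hμ m).2 n).1) (hbound m hm _ (hμ m))
    · refine Tendsto.congr' ?_ (tendsto_walkMoment hl n)
      filter_upwards [eventually_ge_atTop 1] with m hm
      exact ((hμ m).integral_pow hm n).symm
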